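/- Let $m,n,N\ge 0$ be integers and let $p(i)\in\mathbb Z/2$ denote the parity of the $i$-th standard basis vector of the superspace $\mathbb C^{m|n}$, $1\le i\le m+n$ (so $p(i)=0$ for $i\le m$ and $p(i)=1$ for $i>m$). The matrix unit $E_{ij}\in\mathfrak{gl}(m,n)$ has parity $p(i)+p(j)$, and $\mathfrak{gl}(m,n)$ carries the bracket $[X,Y]=\langle XY\rangle-(-1)^{p(X)p(Y)}\langle YX\rangle$ for homogeneous $X,Y$, where $\langle XY\rangle$ is the matrix product. Let $S(\mathfrak{gl}(m,n))$ be the (super)symmetric algebra, with relations $XY=(-1)^{p(X)p(Y)}YX$, and let $U(\mathfrak{gl}(m,n))$ be the universal enveloping algebra, with relations $XY-(-1)^{p(X)p(Y)}YX=[X,Y]$. Special symmetrization. For homogeneous $Y_1,\dots,Y_k,X\in\mathfrak{gl}(m,n)$ put, in $S(\mathfrak{gl}(m,n))$, $$(Y_1\cdots Y_k)*X=Y_1\cdots Y_kX+\sum_{r=1}^k(-1)^{P(r)}\,Y_1\cdots Y_{r-1}\langle Y_rX\rangle Y_{r+1}\cdots Y_k,\qquad P(r)=\sum_{s=r+1}^k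 p(Y_s)p(X).$$ The assignment $1\mapsto 1$, $X_1X_2\cdots X_k\mapsto((\cdots(X_1*X_2)*\cdots)*X_{k-1})*X_k$ is a well-defined linear isomorphism $\tilde\sigma:U(\mathfrak{gl}(m,n))\to S(\mathfrak{gl}(m,n))$; let $\sigma=\tilde\sigma^{-1}$. Actions on $(\mathbb C^{m|n})^{\otimes N}$. A homogeneous $X\in\mathfrak{gl}(m,n)$ acts by $$X(v_1\otimes\cdots\otimes v_N)=\sum_{t=1}^N(-1)^{p(X)(p(v_1)+\cdots+p(v_{t-1}))}\,v_1\otimes\cdots\otimes Xv_t\otimes\cdots\otimes v_N$$ for homogeneous $v_1,\dots,v_N$, and this extends to $U(\mathfrak{gl}(m,n))$. A permutation $\tau\in S_N$ acts by $$\tau(v_1\otimes\cdots\otimes v_N)=\Bigl(\prod_{i<j,\ \tau(i)>\tau(j)}(-1)^{p(v_i)p(v_j)}\Bigr)\,v_{\tau^{-1}(1)}\otimes\cdots\otimes v_{\tau^{-1}(N)},$$ and this extends linearly to $\mathbb C[S_N]$. Let $\rho$ be a partition with parts $\rho_1\ge\dots\ge\rho_l\ge1$ and $k=|\rho|=\rho_1+\cdots+\rho_l\le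 N$. Define $$a_{\rho,N}=\sum_{(i_1,\dots,i_k)}(i_1,\dots,i_{\rho_1})(i_{\rho_1+1},\dots,i_{\rho_1+\rho_2})\cdots(i_{\rho_1+\cdots+\rho_{l-1}+1},\dots,i_k)\in\mathbb C[S_N],$$ where the sum is over all sequences of pairwise distinct elements of $\{1,\dots,N\}$ and $(a,b,\dots,z)$ is the cyclic permutation $a\to b\to\cdots\to z\to a$. For $r\ge1$ define $$I_r=\sum_{i_1,\dots,i_r=1}^{m+n}(-1)^{p(i_2)+\cdots+p(i_r)}E_{i_1i_2}E_{i_2i_3}\cdots E_{i_ri_1}\in S(\mathfrak{gl}(m,n)),\qquad I_\rho=I_{\rho_1}\cdots I_{\rho_l}.$$ **Theorem.** The element $a_{\rho,N}$ lies in the center of $\mathbb C[S_N]$, and $a_{\rho,N}\in\mathbb C[S_N]$ and $\sigma(I_\rho)\in U(\mathfrak{gl}(m,n))$ act on $(\mathbb C^{m|n})^{\otimes N}$ by the same operator. -/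

import Mathlib

open scoped TensorProduct

noncomputable section

namespace SuperSchurWeyl

/-! ### Super vector spaces and matrices -/

/-- Indices of the standard basis of `ℂ^{m|n}`: `inl` are the even ones, `inr` the odd ones. -/
abbrev Idx (m n : ℕ) : Type := Fin m ⊕ Fin n

/-- The parity of an index (of the corresponding basis vector). -/
def par {m n : ℕ} : Idx m n → ZMod 2 := Sum.elim (fun _ => 0) (fun _ => 1)

/-- The superspace `ℂ^{m|n}`. -/
abbrev V (m n : ℕ) : Type := Idx m n → ℂ

/-- The space of matrices underlying the Lie superalgebra `gl(m,n)`. -/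
abbrev gl (m n : ℕ) : Type := Matrix (Idx m n) (Idx m n) ℂ

/-- The sign `(-1)^a`. -/
def sgn (a : ZMod 2) : ℂ := (-1) ^ a.val

lemma sgn_add (a b : ZMod 2) : sgn (a + b) = sgn a * sgn b := by
  rw [sgn, ZMod.val_add, ← neg_one_pow_eq_pow_mod_two, pow_add, sgn, sgn]

lemma sgn_zero : sgn 0 = 1 := by simp [sgn]

lemma sgn_mul_self (a : ZMod 2) : sgn a * sgn a = 1 := by
  rw [← sgn_add, CharTwo.add_self_eq_zero, sgn_zero]

/-- The homogeneous part of parity `a` of `gl(m,n)`. The matrix unit `E_{ij}` has parity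
`p(i) + p(j)`. -/
def glPart (m n : ℕ) (a : ZMod 2) : Submodule ℂ (gl m n) where
  carrier := {X | ∀ i j, par i + par j ≠ a → X i j = 0}
  add_mem' := by
    intro X Y hX hY i j h
    simp [hX i j h, hY i j h]
  zero_mem' := by intro i j _; rfl
  smul_mem' := by
    intro c X hX i j h
    simp [hX i j h]

/-- The homogeneous component of parity `a` of a matrix. -/
def glProj (m n : ℕ) (a : ZMod 2) : gl m n →ₗ[ℂ] gl m n where
  toFun X := Matrix.of fun i j => if par i + par j = a then X i j else 0
  map_add' X Y := by ext i j; by_cases h : par i + par j = a <;> simp [h]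
  map_smul' c X := by ext i j; simp

/-- The `b`-th power of the parity automorphism of `gl(m,n)`: a matrix of parity `a` is
multiplied by `(-1)^{ab}`. -/
def glSign (m n : ℕ) (b : ZMod 2) : gl m n →ₗ[ℂ] gl m n where
  toFun X := Matrix.of fun i j => sgn (b * (par i + par j)) * X i j
  map_add' X Y := by ext i j; simp [mul_add]
  map_smul' c X := by ext i j; simp; ring

/-- The `b`-th power of the parity automorphism of `ℂ^{m|n}`: a vector of parity `a` is
multiplied by `(-1)^{ab}`. -/
def vecSign (m n : ℕ) (b : ZMod 2) : V m n →ₗ[ℂ] V m n where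
  toFun v := fun i => sgn (b * par i) * v i
  map_add' X Y := by ext i; simp [mul_add]
  map_smul' c X := by ext i; simp; ring

/-- The homogeneous component of parity `a` of a vector. -/
def vecProj (m n : ℕ) (a : ZMod 2) : V m n →ₗ[ℂ] V m n where
  toFun v := fun i => if par i = a then v i else 0
  map_add' X Y := by ext i; by_cases h : par i = a <;> simp [h]
  map_smul' c X := by ext i; simp

section basics

variable {m n : ℕ}

lemma glProj_mem (a : ZMod 2) (X : gl m n) : glProj m n a X ∈ glPart m n a := by
  intro i j h
  simp [glProj, h]

lemma glProj_of_mem {a : ZMod 2} {X : gl m n} (hX : X ∈ glPart m n a) :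
    glProj m n a X = X := by
  ext i j
  by_cases h : par i + par j = a
  · simp [glProj, h]
  · simp [glProj, h, hX i j h]

lemma glProj_of_mem_ne {a b : ZMod 2} {X : gl m n} (hX : X ∈ glPart m n a) (hab : b ≠ a) :
    glProj m n b X = 0 := by
  ext i j
  by_cases h : par i + par j = b
  · simp [glProj, h, hX i j (by rw [h]; exact hab)]
  · simp [glProj, h]

lemma sum_glProj (X : gl m n) : ∑ a, glProj m n a X = X := by
  ext i j
  simp [glProj, Matrix.sum_apply]

lemma glSign_of_mem {a : ZMod 2} (b : ZMod 2) {X : gl m n} (hX : X ∈ glPart m n a) :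
    glSign m n b X = sgn (b * a) • X := by
  ext i j
  by_cases h : par i + par j = a
  · simp [glSign, h]
  · simp [glSign, hX i j h]

lemma glSign_mem {a : ZMod 2} (b : ZMod 2) {X : gl m n} (hX : X ∈ glPart m n a) :
    glSign m n b X ∈ glPart m n a := by
  rw [glSign_of_mem b hX]
  exact Submodule.smul_mem _ _ hX

lemma glSign_comm (a b : ZMod 2) (X : gl m n) :
    glSign m n a (glSign m n b X) = glSign m n b (glSign m n a X) := by
  ext i j
  simp [glSign]
  ring

lemma glSign_glSign (a b : ZMod 2) (X : gl m n) :
    glSign m n a (glSign m n b X) = glSign m n (a + b) X := by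
  ext i j
  simp [glSign, add_mul, sgn_add]
  ring

lemma glSign_mul (a : ZMod 2) (X Y : gl m n) :
    glSign m n a (X * Y) = glSign m n a X * glSign m n a Y := by
  ext i j
  simp only [glSign, LinearMap.coe_mk, AddHom.coe_mk, Matrix.of_apply, Matrix.mul_apply,
    Finset.mul_sum]
  refine Finset.sum_congr rfl fun k _ => ?_
  have : sgn (a * (par i + par j)) = sgn (a * (par i + par k)) * sgn (a * (par k + par j)) := by
    rw [← sgn_add, ← mul_add]
    congr 2
    linear_combination (-(1 : ZMod 2)) * CharTwo.add_self_eq_zero (par k)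
  rw [this]
  ring

lemma mul_mem_glPart {a b : ZMod 2} {X Y : gl m n} (hX : X ∈ glPart m n a)
    (hY : Y ∈ glPart m n b) : X * Y ∈ glPart m n (a + b) := by
  intro i j h
  rw [Matrix.mul_apply]
  refine Finset.sum_eq_zero fun k _ => ?_
  by_cases h1 : par i + par k = a
  · by_cases h2 : par k + par j = b
    · exfalso
      apply h
      rw [← h1, ← h2]
      linear_combination (-(1 : ZMod 2)) * CharTwo.add_self_eq_zero (par k)
    · rw [hY k j h2, mul_zero]
  · rw [hX i k h1, zero_mul]

end basics

/-! ### The superalgebras `S(gl(m,n))` and `U(gl(m,n))` -/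

/-- The defining relations `X Y = (-1)^{p(X)p(Y)} Y X` of the supersymmetric algebra. -/
inductive SymRel (m n : ℕ) : TensorAlgebra ℂ (gl m n) → TensorAlgebra ℂ (gl m n) → Prop
  | comm {a b : ZMod 2} {X Y : gl m n} (hX : X ∈ glPart m n a) (hY : Y ∈ glPart m n b) :
      SymRel m n (TensorAlgebra.ι ℂ X * TensorAlgebra.ι ℂ Y)
        (sgn (a * b) • (TensorAlgebra.ι ℂ Y * TensorAlgebra.ι ℂ X))

/-- The defining relations `X Y = (-1)^{p(X)p(Y)} Y X + [X, Y]` of the enveloping algebra, where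
`[X, Y] = ⟨X Y⟩ - (-1)^{p(X)p(Y)} ⟨Y X⟩` is the bracket of the Lie superalgebra `gl(m,n)`. -/
inductive EnvRel (m n : ℕ) : TensorAlgebra ℂ (gl m n) → TensorAlgebra ℂ (gl m n) → Prop
  | bracket {a b : ZMod 2} {X Y : gl m n} (hX : X ∈ glPart m n a) (hY : Y ∈ glPart m n b) :
      EnvRel m n (TensorAlgebra.ι ℂ X * TensorAlgebra.ι ℂ Y)
        (sgn (a * b) • (TensorAlgebra.ι ℂ Y * TensorAlgebra.ι ℂ X) +
          TensorAlgebra.ι ℂ (X * Y - sgn (a * b) • (Y * X)))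

/-- The symmetric algebra `S(gl(m,n))` of the superspace `gl(m,n)`. -/
def SymAlg (m n : ℕ) : Type := RingQuot (SymRel m n)

instance (m n : ℕ) : Ring (SymAlg m n) := inferInstanceAs (Ring (RingQuot (SymRel m n)))

instance (m n : ℕ) : Algebra ℂ (SymAlg m n) :=
  inferInstanceAs (Algebra ℂ (RingQuot (SymRel m n)))

/-- The universal enveloping algebra `U(gl(m,n))` of the Lie superalgebra `gl(m,n)`. -/
def EnvAlg (m n : ℕ) : Type := RingQuot (EnvRel m n)

instance (m n : ℕ) : Ring (EnvAlg m n) := inferInstanceAs (Ring (RingQuot (EnvRel m n)))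

instance (m n : ℕ) : Algebra ℂ (EnvAlg m n) :=
  inferInstanceAs (Algebra ℂ (RingQuot (EnvRel m n)))

/-- The quotient map `T(gl(m,n)) → S(gl(m,n))`. -/
def symMk (m n : ℕ) : TensorAlgebra ℂ (gl m n) →ₐ[ℂ] SymAlg m n :=
  RingQuot.mkAlgHom ℂ (SymRel m n)

/-- The quotient map `T(gl(m,n)) → U(gl(m,n))`. -/
def envMk (m n : ℕ) : TensorAlgebra ℂ (gl m n) →ₐ[ℂ] EnvAlg m n :=
  RingQuot.mkAlgHom ℂ (EnvRel m n)

/-- The canonical map `gl(m,n) → S(gl(m,n))`. -/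
def symι (m n : ℕ) : gl m n →ₗ[ℂ] SymAlg m n :=
  (symMk m n).toLinearMap ∘ₗ TensorAlgebra.ι ℂ

/-- The canonical map `gl(m,n) → U(gl(m,n))`. -/
def envι (m n : ℕ) : gl m n →ₗ[ℂ] EnvAlg m n :=
  (envMk m n).toLinearMap ∘ₗ TensorAlgebra.ι ℂ

section universal

variable {m n : ℕ} {B : Type*} [Semiring B] [Algebra ℂ B]

/-- The universal property of `S(gl(m,n))`. -/
def symLift (f : gl m n →ₗ[ℂ] B)
    (hf : ∀ {a b : ZMod 2} {X Y : gl m n}, X ∈ glPart m n a → Y ∈ glPart m n b →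
      f X * f Y = sgn (a * b) • (f Y * f X)) : SymAlg m n →ₐ[ℂ] B :=
  RingQuot.liftAlgHom ℂ ⟨TensorAlgebra.lift ℂ f, by
    rintro _ _ ⟨hX, hY⟩
    simpa using hf hX hY⟩

/-- The universal property of `U(gl(m,n))`. -/
def envLift (f : gl m n →ₗ[ℂ] B)
    (hf : ∀ {a b : ZMod 2} {X Y : gl m n}, X ∈ glPart m n a → Y ∈ glPart m n b →
      f X * f Y = sgn (a * b) • (f Y * f X) + f (X * Y - sgn (a * b) • (Y * X))) :
    EnvAlg m n →ₐ[ℂ] B :=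
  RingQuot.liftAlgHom ℂ ⟨TensorAlgebra.lift ℂ f, by
    rintro _ _ ⟨hX, hY⟩
    simpa only [map_mul, map_add, map_smul, TensorAlgebra.lift_ι_apply] using hf hX hY⟩

lemma symLift_ι (f : gl m n →ₗ[ℂ] B) (hf) (X : gl m n) :
    symLift f hf (symι m n X) = f X :=
  (RingQuot.liftAlgHom_mkAlgHom_apply ℂ _ _ _).trans (TensorAlgebra.lift_ι_apply f X)

lemma envLift_ι (f : gl m n →ₗ[ℂ] B) (hf) (X : gl m n) :
    envLift f hf (envι m n X) = f X :=
  (RingQuot.liftAlgHom_mkAlgHom_apply ℂ _ _ _).trans (TensorAlgebra.lift_ι_apply f X)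

lemma symι_comm {a b : ZMod 2} {X Y : gl m n} (hX : X ∈ glPart m n a) (hY : Y ∈ glPart m n b) :
    symι m n X * symι m n Y = sgn (a * b) • (symι m n Y * symι m n X) := by
  have h : symMk m n _ = symMk m n _ := RingQuot.mkAlgHom_rel ℂ (SymRel.comm hX hY)
  simpa [symι] using h

lemma envι_comm {a b : ZMod 2} {X Y : gl m n} (hX : X ∈ glPart m n a) (hY : Y ∈ glPart m n b) :
    envι m n X * envι m n Y - sgn (a * b) • (envι m n Y * envι m n X) =
      envι m n (X * Y - sgn (a * b) • (Y * X)) := by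
  have h : envMk m n _ = envMk m n _ := RingQuot.mkAlgHom_rel ℂ (EnvRel.bracket hX hY)
  rw [map_add, map_smul, map_mul, map_mul] at h
  exact sub_eq_of_eq_add' h

lemma quot_induction {φ : TensorAlgebra ℂ (gl m n) →ₐ[ℂ] B} (hφ : Function.Surjective φ)
    {C : B → Prop} (one : C 1) (smul : ∀ (c : ℂ) x, C x → C (c • x))
    (add : ∀ x y, C x → C y → C (x + y))
    (mul : ∀ x X, C x → C (x * φ (TensorAlgebra.ι ℂ X))) (x : B) : C x := by
  obtain ⟨t, rfl⟩ := hφ x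
  have key : ∀ y, C y → C (y * φ t) := by
    induction t using TensorAlgebra.induction with
    | algebraMap c =>
      intro y hy
      rw [AlgHom.commutes, ← Algebra.commutes, ← Algebra.smul_def]
      exact smul c y hy
    | ι X => exact fun y hy => mul y X hy
    | mul a b ha hb =>
      intro y hy
      rw [map_mul, ← mul_assoc]
      exact hb _ (ha _ hy)
    | add a b ha hb =>
      intro y hy
      rw [map_add, mul_add]
      exact add _ _ (ha _ hy) (hb _ hy)
  simpa using key 1 one

/-- An induction principle for `S(gl(m,n))`: it is spanned by the monomials. -/
lemma sym_induction {C : SymAlg m n → Prop} (one : C 1) (smul : ∀ (c : ℂ) x, C x → C (c • x))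
    (add : ∀ x y, C x → C y → C (x + y))
    (mul : ∀ x X, C x → C (x * symι m n X)) (x : SymAlg m n) : C x :=
  quot_induction (φ := symMk m n) (RingQuot.mkAlgHom_surjective ℂ _) one smul add mul x

/-- An induction principle for `U(gl(m,n))`: it is spanned by the monomials. -/
lemma env_induction {C : EnvAlg m n → Prop} (one : C 1) (smul : ∀ (c : ℂ) x, C x → C (c • x))
    (add : ∀ x y, C x → C y → C (x + y))
    (mul : ∀ x X, C x → C (x * envι m n X)) (x : EnvAlg m n) : C x :=
  quot_induction (φ := envMk m n) (RingQuot.mkAlgHom_surjective ℂ _) one smul add mul x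

end universal

/-! ### Right actions -/

section rightActions

variable {m n : ℕ} {W : Type*} [AddCommGroup W] [Module ℂ W]

/-- The right action of `S(gl(m,n))` with prescribed action of `gl(m,n)`. -/
def symAct (f : gl m n →ₗ[ℂ] Module.End ℂ W)
    (hf : ∀ {a b : ZMod 2} {X Y : gl m n}, X ∈ glPart m n a → Y ∈ glPart m n b →
      f Y * f X = sgn (a * b) • (f X * f Y)) : SymAlg m n →ₗ[ℂ] Module.End ℂ W :=
  (MulOpposite.opLinearEquiv ℂ).symm.toLinearMap ∘ₗ
    (symLift ((MulOpposite.opLinearEquiv ℂ).toLinearMap ∘ₗ f) (by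
      intro a b X Y hX hY
      simpa using congrArg MulOpposite.op (hf hX hY))).toLinearMap

/-- The right action of `U(gl(m,n))` with prescribed action of `gl(m,n)`. -/
def envAct (f : gl m n →ₗ[ℂ] Module.End ℂ W)
    (hf : ∀ {a b : ZMod 2} {X Y : gl m n}, X ∈ glPart m n a → Y ∈ glPart m n b →
      f Y * f X - sgn (a * b) • (f X * f Y) = f (X * Y - sgn (a * b) • (Y * X))) :
    EnvAlg m n →ₗ[ℂ] Module.End ℂ W :=
  (MulOpposite.opLinearEquiv ℂ).symm.toLinearMap ∘ₗ
    (envLift ((MulOpposite.opLinearEquiv ℂ).toLinearMap ∘ₗ f) (by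
      intro a b X Y hX hY
      exact congrArg MulOpposite.op (sub_eq_iff_eq_add'.mp (hf hX hY)))).toLinearMap

lemma symAct_one (f : gl m n →ₗ[ℂ] Module.End ℂ W) (hf) : symAct f hf 1 = 1 := by
  simp [symAct]

lemma symAct_mul (f : gl m n →ₗ[ℂ] Module.End ℂ W) (hf) (A : SymAlg m n) (X : gl m n) (w : W) :
    symAct f hf (A * symι m n X) w = f X (symAct f hf A w) := by
  simp [symAct, symLift_ι]

lemma envAct_one (f : gl m n →ₗ[ℂ] Module.End ℂ W) (hf) : envAct f hf 1 = 1 := by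
  simp [envAct]

lemma envAct_mul (f : gl m n →ₗ[ℂ] Module.End ℂ W) (hf) (A : EnvAlg m n) (X : gl m n) (w : W) :
    envAct f hf (A * envι m n X) w = f X (envAct f hf A w) := by
  simp [envAct, envLift_ι]

end rightActions

/-- Two linear maps out of `gl(m,n)` agree if they agree on homogeneous elements. -/
lemma eq_of_hom {m n : ℕ} {W : Type*} [AddCommGroup W] [Module ℂ W] {f g : gl m n →ₗ[ℂ] W}
    (h : ∀ (a : ZMod 2) (X : gl m n), X ∈ glPart m n a → f X = g X) : f = g := by
  ext1 X
  rw [← sum_glProj X, map_sum, map_sum]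
  exact Finset.sum_congr rfl fun a _ => h a _ (glProj_mem a X)

/-! ### The operation `A * X` and the map `U(gl(m,n)) → S(gl(m,n))` -/

/-- One step of the recursion which defines the substitution terms of `A * X`. -/
def substStep (m n : ℕ) :
    gl m n →ₗ[ℂ] Module.End ℂ (SymAlg m n × (gl m n →ₗ[ℂ] SymAlg m n)) :=
  LinearMap.mk₂ ℂ
    (fun Y p => (p.1 * symι m n Y,
      LinearMap.mulLeft ℂ p.1 ∘ₗ symι m n ∘ₗ LinearMap.mulLeft ℂ Y +
        ∑ c, LinearMap.mulRight ℂ (symι m n (glProj m n c Y)) ∘ₗ p.2 ∘ₗ glSign m n c))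
    (by
      intro Y Y' p
      ext1
      · simp [mul_add]
      · ext X
        simp [mul_add, add_mul, Finset.sum_add_distrib]
        abel)
    (by
      intro c Y p
      ext1
      · simp
      · ext X
        simp [Finset.smul_sum])
    (by
      intro Y p p'
      ext1
      · simp [add_mul]
      · ext X
        simp [add_mul, Finset.sum_add_distrib]
        abel)
    (by
      intro c Y p
      ext1
      · simp
      · ext X
        simp [Finset.smul_sum])

lemma substStep_fst {m n : ℕ} (Y : gl m n) (p : SymAlg m n × (gl m n →ₗ[ℂ] SymAlg m n)) :
    (substStep m n Y p).1 = p.1 * symι m n Y := rfl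

lemma substStep_snd {m n : ℕ} {b : ZMod 2} {Y : gl m n} (hY : Y ∈ glPart m n b)
    (p : SymAlg m n × (gl m n →ₗ[ℂ] SymAlg m n)) (X : gl m n) :
    (substStep m n Y p).2 X =
      p.1 * symι m n (Y * X) + p.2 (glSign m n b X) * symι m n Y := by
  have : ∑ c, p.2 (glSign m n c X) * symι m n (glProj m n c Y) =
      p.2 (glSign m n b X) * symι m n Y := by
    rw [Finset.sum_eq_single b]
    · rw [glProj_of_mem hY]
    · intro c _ hc
      rw [glProj_of_mem_ne hY hc, map_zero, mul_zero]
    · simp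
  rw [← this]
  simp [substStep]

lemma substStep_comm {m n : ℕ} {a b : ZMod 2} {Y Z : gl m n} (hY : Y ∈ glPart m n a)
    (hZ : Z ∈ glPart m n b) : substStep m n Z * substStep m n Y =
      sgn (a * b) • (substStep m n Y * substStep m n Z) := by
  refine LinearMap.ext fun p => ?_
  apply Prod.ext
  · simp only [Module.End.mul_apply, LinearMap.smul_apply, Prod.smul_fst, substStep_fst]
    rw [mul_assoc, symι_comm hY hZ, mul_smul_comm, mul_assoc]
  · refine eq_of_hom fun c X hX => ?_
    simp only [Module.End.mul_apply, LinearMap.smul_apply, Prod.smul_snd, substStep_fst,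
      substStep_snd hY, substStep_snd hZ, glSign_of_mem _ hX, map_smul, mul_assoc,
      mul_smul_comm, smul_mul_assoc, smul_add, smul_smul, add_mul]
    rw [symι_comm (mul_mem_glPart hY hX) hZ, symι_comm hY (mul_mem_glPart hZ hX),
      symι_comm hY hZ]
    simp only [smul_smul, mul_smul_comm, mul_add, add_mul, sgn_add]
    have e1 := sgn_mul_self (a * b)
    have e2 := sgn_mul_self (a * c)
    have e3 := sgn_mul_self (b * c)
    rw [mul_comm c b]
    match_scalars <;> grind

/-- The map `A ↦ (X ↦ A * X - A X)`: for homogeneous elements it sends a monomial `Y_1 ... Y_k` to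
`∑_r (-1)^{P(r)} Y_1 ... ⟨Y_r X⟩ ... Y_k`, where `P(r) = ∑_{s > r} p(Y_s) p(X)`. -/
def substTerm (m n : ℕ) : SymAlg m n →ₗ[ℂ] gl m n →ₗ[ℂ] SymAlg m n :=
  LinearMap.snd ℂ (SymAlg m n) (gl m n →ₗ[ℂ] SymAlg m n) ∘ₗ
    LinearMap.applyₗ ((1 : SymAlg m n), (0 : gl m n →ₗ[ℂ] SymAlg m n)) ∘ₗ
    symAct (W := SymAlg m n × (gl m n →ₗ[ℂ] SymAlg m n)) (substStep m n) substStep_comm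

lemma symAct_substStep_fst {m n : ℕ} (A : SymAlg m n) :
    (symAct (W := SymAlg m n × (gl m n →ₗ[ℂ] SymAlg m n)) (substStep m n) substStep_comm A
      (1, 0)).1 = A := by
  induction A using sym_induction with
  | one => simp [symAct_one]
  | smul c x hx => simp [hx]
  | add x y hx hy => simp [hx, hy]
  | mul x X hx => rw [symAct_mul, substStep_fst, hx]

section substTerm

variable {m n : ℕ}

lemma substTerm_one (X : gl m n) : substTerm m n 1 X = 0 := by
  simp [substTerm, symAct_one]

lemma substTerm_mul {b : ZMod 2} {Y : gl m n} (hY : Y ∈ glPart m n b) (A : SymAlg m n) (X : gl m n) :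
    substTerm m n (A * symι m n Y) X =
      A * symι m n (Y * X) + substTerm m n A (glSign m n b X) * symι m n Y := by
  simp only [substTerm, LinearMap.comp_apply, LinearMap.applyₗ_apply_apply, symAct_mul,
    LinearMap.snd_apply, substStep_snd hY, symAct_substStep_fst]

end substTerm

/-- The operation `A * X` on `S(gl(m,n))`, as a map `X ↦ (A ↦ A * X)`. -/
def starMap (m n : ℕ) : gl m n →ₗ[ℂ] Module.End ℂ (SymAlg m n) :=
  (LinearMap.mul ℂ (SymAlg m n)).flip ∘ₗ symι m n + (substTerm m n).flip

section star

variable {m n : ℕ}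

lemma starMap_apply (X : gl m n) (A : SymAlg m n) :
    starMap m n X A = A * symι m n X + substTerm m n A X := rfl

/-- The defining formula of the operation `*` on monomials:
`(Y_1 ... Y_k) * X = Y_1 ... Y_k X + ∑_r (-1)^{P(r)} Y_1 ... ⟨Y_r X⟩ ... Y_k` with
`P(r) = ∑_{s > r} p(Y_s) p(X)`. -/
theorem starMap_monomial {k : ℕ} (Y : Fin k → gl m n) (q : Fin k → ZMod 2)
    (hY : ∀ r, Y r ∈ glPart m n (q r)) {b : ZMod 2} {X : gl m n} (hX : X ∈ glPart m n b) :
    starMap m n X (List.ofFn fun r => symι m n (Y r)).prod =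
      (List.ofFn fun r => symι m n (Y r)).prod * symι m n X +
        ∑ r, sgn (∑ s ∈ Finset.Ioi r, q s * b) •
          (List.ofFn fun s => symι m n (if s = r then Y s * X else Y s)).prod := by
  rw [starMap_apply]
  congr 1
  induction k with
  | zero => simp [substTerm_one]
  | succ k ih =>
    have hI (r : Fin k) : Finset.Ioi r.castSucc =
        insert (Fin.last k) ((Finset.Ioi r).map Fin.castSuccEmb) := by
      ext s
      induction s using Fin.lastCases with
      | last => simp [Fin.castSucc_lt_last]
      | cast s => simp [Fin.le_last]
    have hI' : Finset.Ioi (Fin.last k) = ∅ := by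
      ext s
      simp [Fin.le_last]
    have hne (r : Fin k) : Fin.last k ≠ r.castSucc := (Fin.castSucc_lt_last r).ne'
    have hne' (r : Fin k) : r.castSucc ≠ Fin.last k := (Fin.castSucc_lt_last r).ne
    simp only [List.ofFn_succ', List.concat_eq_append, List.prod_append, List.prod_singleton]
    rw [substTerm_mul (hY _), glSign_of_mem _ hX, map_smul,
      ih (fun r => Y r.castSucc) (fun r => q r.castSucc) (fun r => hY _), Fin.sum_univ_castSucc,
      add_comm]
    have hS (r : Fin k) : ∑ s ∈ Finset.Ioi r.castSucc, q s * b =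
        q (Fin.last k) * b + ∑ s ∈ Finset.Ioi r, q s.castSucc * b := by
      rw [hI, Finset.sum_insert (by simp), Finset.sum_map]
      rfl
    simp only [hS, hI', Finset.smul_sum, Finset.sum_mul]
    simp [hne, hne', sgn_zero, sgn_add, smul_smul]

lemma substTerm_comm {a b : ZMod 2} {X Y : gl m n} (hX : X ∈ glPart m n a)
    (hY : Y ∈ glPart m n b) (A : SymAlg m n) :
    substTerm m n (substTerm m n A X) Y - sgn (a * b) • substTerm m n (substTerm m n A Y) X =
      substTerm m n A (X * Y - sgn (a * b) • (Y * X)) := by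
  induction A using sym_induction with
  | one => simp [substTerm_one]
  | smul c x hx => simp only [map_smul, LinearMap.smul_apply, ← hx, smul_sub, smul_comm c]
  | add x y hx hy =>
    simp only [map_add, LinearMap.add_apply, ← hx, ← hy, smul_add]
    abel
  | mul x Z hx =>
    have h : ∀ Z, substTerm m n (substTerm m n (x * symι m n Z) X) Y -
        sgn (a * b) • substTerm m n (substTerm m n (x * symι m n Z) Y) X -
      substTerm m n (x * symι m n Z) (X * Y - sgn (a * b) • (Y * X)) = 0 := by
      intro Z
      rw [← sum_glProj Z, map_sum, Finset.mul_sum]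
      simp only [map_sum, LinearMap.sum_apply, Finset.smul_sum, ← Finset.sum_sub_distrib]
      refine Finset.sum_eq_zero fun c _ => ?_
      have hZ := glProj_mem c Z
      generalize glProj m n c Z = Z at hZ
      have hc : sgn (a * b) * sgn (a * b) = 1 := sgn_mul_self _
      have h1 := sgn_mul_self (c * a)
      have h2 := sgn_mul_self (c * b)
      simp only [substTerm_mul hZ, substTerm_mul (mul_mem_glPart hZ hX),
        substTerm_mul (mul_mem_glPart hZ hY), glSign_of_mem _ hX, glSign_of_mem _ hY, map_add,
        map_sub, LinearMap.add_apply, LinearMap.smul_apply, map_smul, smul_mul_assoc, add_mul,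
        sgn_add, mul_add, smul_add, smul_smul, mul_sub, mul_smul_comm,
        glSign_of_mem _ (mul_mem_glPart hX hY), glSign_of_mem _ (mul_mem_glPart hY hX),
        sub_mul, mul_assoc] at hx ⊢
      have hx' := congrArg (fun z => (sgn (c * a) * sgn (c * b)) • (z * symι m n Z)) hx
      simp only [sub_mul, smul_sub, smul_mul_assoc, smul_smul] at hx'
      have e3 : sgn (b * a) = sgn (a * b) := by rw [mul_comm]
      rw [← sub_eq_zero] at hx'
      rw [← hx']
      rw [e3]
      match_scalars <;> grind
    exact sub_eq_zero.mp (h Z)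

lemma starMap_comm {a b : ZMod 2} {X Y : gl m n} (hX : X ∈ glPart m n a)
    (hY : Y ∈ glPart m n b) :
    starMap m n Y * starMap m n X - sgn (a * b) • (starMap m n X * starMap m n Y) =
      starMap m n (X * Y - sgn (a * b) • (Y * X)) := by
  refine LinearMap.ext fun A => ?_
  have h := substTerm_comm hX hY A
  have h1 := sgn_mul_self (a * b)
  have e3 : sgn (b * a) = sgn (a * b) := by rw [mul_comm]
  simp only [LinearMap.sub_apply, Module.End.mul_apply, LinearMap.smul_apply, starMap_apply]
  rw [← h]
  simp only [map_add, map_sub, map_smul, LinearMap.add_apply, substTerm_mul hX, substTerm_mul hY,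
    glSign_of_mem _ hX, glSign_of_mem _ hY, mul_assoc, symι_comm hX hY, add_mul, mul_sub,
    mul_smul_comm, smul_mul_assoc, smul_add, smul_smul, e3]
  match_scalars <;> grind

end star

/-- The linear map `U(gl(m,n)) → S(gl(m,n))` which sends a monomial `X_1 X_2 ... X_k` to
`((X_1 * X_2) * ... ) * X_k = (((1 * X_1) * X_2) * ... ) * X_k`. -/
def symbolMap (m n : ℕ) : EnvAlg m n →ₗ[ℂ] SymAlg m n :=
  LinearMap.applyₗ (1 : SymAlg m n) ∘ₗ envAct (W := SymAlg m n) (starMap m n) starMap_comm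

section symbol

variable {m n : ℕ}

lemma symbolMap_one : symbolMap m n 1 = 1 := by
  simp [symbolMap, envAct_one]

lemma symbolMap_mul (u : EnvAlg m n) (X : gl m n) :
    symbolMap m n (u * envι m n X) = starMap m n X (symbolMap m n u) := by
  simp only [symbolMap, LinearMap.comp_apply, LinearMap.applyₗ_apply_apply, envAct_mul]

end symbol

/-! ### Invertibility of the map `U(gl(m,n)) → S(gl(m,n))`

The inverse is built from the operators on `U(gl(m,n))` which correspond to `substTerm`. -/

/-- One step of the recursion which defines `envTerm`. -/
def envStep (m n : ℕ) :
    gl m n →ₗ[ℂ] Module.End ℂ (EnvAlg m n × (gl m n →ₗ[ℂ] EnvAlg m n)) :=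
  LinearMap.mk₂ ℂ
    (fun X p => (p.1 * envι m n X,
      LinearMap.mulLeft ℂ p.1 ∘ₗ envι m n ∘ₗ LinearMap.mulLeft ℂ X +
        ∑ c, (LinearMap.mulRight ℂ (envι m n (glProj m n c X)) ∘ₗ p.2 ∘ₗ glSign m n c -
          p.2 ∘ₗ LinearMap.mulRight ℂ (glProj m n c X) ∘ₗ glSign m n c)))
    (by
      intro Y Y' p
      ext1
      · simp [mul_add]
      · ext X
        simp [mul_add, add_mul, Finset.sum_add_distrib]
        abel)
    (by
      intro c Y p
      ext1
      · simp
      · ext X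
        simp [Finset.smul_sum, smul_sub])
    (by
      intro Y p p'
      ext1
      · simp [add_mul]
      · ext X
        simp [add_mul, Finset.sum_add_distrib]
        abel)
    (by
      intro c Y p
      ext1
      · simp
      · ext X
        simp [Finset.smul_sum, smul_sub])

lemma envStep_fst {m n : ℕ} (X : gl m n) (p : EnvAlg m n × (gl m n →ₗ[ℂ] EnvAlg m n)) :
    (envStep m n X p).1 = p.1 * envι m n X := rfl

lemma envStep_snd {m n : ℕ} {a : ZMod 2} {X : gl m n} (hX : X ∈ glPart m n a)
    (p : EnvAlg m n × (gl m n →ₗ[ℂ] EnvAlg m n)) (Y : gl m n) :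
    (envStep m n X p).2 Y = p.1 * envι m n (X * Y) +
      (p.2 (glSign m n a Y) * envι m n X - p.2 (glSign m n a Y * X)) := by
  have : ∑ c, (p.2 (glSign m n c Y) * envι m n (glProj m n c X) -
      p.2 (glSign m n c Y * glProj m n c X)) =
      p.2 (glSign m n a Y) * envι m n X - p.2 (glSign m n a Y * X) := by
    rw [Finset.sum_eq_single a]
    · rw [glProj_of_mem hX]
    · intro c _ hc
      rw [glProj_of_mem_ne hX hc]
      simp
    · simp
  rw [← this]
  simp [envStep]

lemma envι_swap {m n : ℕ} {a b : ZMod 2} {X Y : gl m n} (hX : X ∈ glPart m n a)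
    (hY : Y ∈ glPart m n b) : envι m n X * envι m n Y =
      sgn (a * b) • (envι m n Y * envι m n X) + envι m n (X * Y) -
        sgn (a * b) • envι m n (Y * X) := by
  have := envι_comm hX hY
  rw [map_sub, map_smul, sub_eq_iff_eq_add] at this
  rw [this]
  abel

lemma envStep_comm {m n : ℕ} {a b : ZMod 2} {X Z : gl m n} (hX : X ∈ glPart m n a)
    (hZ : Z ∈ glPart m n b) :
    envStep m n Z * envStep m n X - sgn (a * b) • (envStep m n X * envStep m n Z) =
      envStep m n (X * Z - sgn (a * b) • (Z * X)) := by
  have e1 := sgn_mul_self (a * b)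
  refine LinearMap.ext fun p => ?_
  apply Prod.ext
  · simp only [Module.End.mul_apply, LinearMap.smul_apply, LinearMap.sub_apply, Prod.smul_fst,
      Prod.fst_sub, envStep_fst, mul_assoc]
    rw [← mul_smul_comm, ← mul_sub, envι_comm hX hZ]
  · refine eq_of_hom fun c Y hY => ?_
    have e2 := sgn_mul_self (a * c)
    have e3 := sgn_mul_self (b * c)
    have hZX : Z * X ∈ glPart m n (a + b) := add_comm b a ▸ mul_mem_glPart hZ hX
    have hb : (X * Z - sgn (a * b) • (Z * X)) ∈ glPart m n (a + b) :=
      Submodule.sub_mem _ (mul_mem_glPart hX hZ) (Submodule.smul_mem _ _ hZX)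
    simp only [Module.End.mul_apply, LinearMap.smul_apply, LinearMap.sub_apply, Prod.smul_snd,
      Prod.snd_sub, envStep_fst, envStep_snd hb, envStep_snd hX, envStep_snd hZ,
      glSign_of_mem _ hY, map_smul, smul_mul_assoc, glSign_of_mem _ (mul_mem_glPart hY hX),
      glSign_of_mem _ (mul_mem_glPart hY hZ)]
    simp only [map_sub, map_smul, mul_sub, sub_mul, smul_mul_assoc, mul_smul_comm, smul_sub,
      smul_add, smul_smul, add_mul, mul_assoc]
    rw [envι_swap hX (mul_mem_glPart hZ hY), envι_swap hX hZ,
      envι_swap hZ (mul_mem_glPart hX hY)]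
    simp only [mul_sub, mul_smul_comm, smul_sub, smul_add, smul_smul, mul_add, sgn_add, mul_assoc]
    rw [mul_comm b a]
    match_scalars <;> grind

/-- The operators on `U(gl(m,n))` which correspond to `substTerm`. -/
def envTerm (m n : ℕ) : EnvAlg m n →ₗ[ℂ] gl m n →ₗ[ℂ] EnvAlg m n :=
  LinearMap.snd ℂ (EnvAlg m n) (gl m n →ₗ[ℂ] EnvAlg m n) ∘ₗ
    LinearMap.applyₗ ((1 : EnvAlg m n), (0 : gl m n →ₗ[ℂ] EnvAlg m n)) ∘ₗ
    envAct (W := EnvAlg m n × (gl m n →ₗ[ℂ] EnvAlg m n)) (envStep m n) envStep_comm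

lemma envAct_envStep_fst {m n : ℕ} (u : EnvAlg m n) :
    (envAct (W := EnvAlg m n × (gl m n →ₗ[ℂ] EnvAlg m n)) (envStep m n) envStep_comm u
      (1, 0)).1 = u := by
  induction u using env_induction with
  | one => simp [envAct_one]
  | smul c x hx => simp [hx]
  | add x y hx hy => simp [hx, hy]
  | mul x X hx => rw [envAct_mul, envStep_fst, hx]

section envTerm

variable {m n : ℕ}

lemma envTerm_one (Y : gl m n) : envTerm m n 1 Y = 0 := by
  simp [envTerm, envAct_one]

lemma envTerm_mul {a : ZMod 2} {X : gl m n} (hX : X ∈ glPart m n a) (u : EnvAlg m n)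
    (Y : gl m n) : envTerm m n (u * envι m n X) Y = u * envι m n (X * Y) +
      (envTerm m n u (glSign m n a Y) * envι m n X - envTerm m n u (glSign m n a Y * X)) := by
  simp only [envTerm, LinearMap.comp_apply, LinearMap.applyₗ_apply_apply, envAct_mul,
    LinearMap.snd_apply, envStep_snd hX, envAct_envStep_fst]

lemma symbolMap_envTerm (u : EnvAlg m n) :
    symbolMap m n ∘ₗ envTerm m n u = substTerm m n (symbolMap m n u) := by
  induction u using env_induction with
  | one =>
    ext1 Y
    simp [symbolMap_one, envTerm_one, substTerm_one]
  | smul c x hx => rw [map_smul, map_smul, map_smul, ← hx, LinearMap.comp_smul]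
  | add x y hx hy => rw [map_add, map_add, map_add, ← hx, ← hy, LinearMap.comp_add]
  | mul u X hu =>
    have hu' : ∀ Y, symbolMap m n (envTerm m n u Y) = substTerm m n (symbolMap m n u) Y :=
      fun Y => by rw [← hu]; rfl
    refine LinearMap.ext fun Y => ?_
    rw [LinearMap.comp_apply, ← sub_eq_zero, ← sum_glProj X, ← sum_glProj Y]
    simp only [Finset.mul_sum, map_sum, LinearMap.sum_apply, ← Finset.sum_sub_distrib]
    refine Finset.sum_eq_zero fun c _ => ?_
    refine Finset.sum_eq_zero fun a _ => ?_
    have hX := glProj_mem a X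
    have hY := glProj_mem c Y
    generalize glProj m n a X = X at hX
    generalize glProj m n c Y = Y at hY
    have e1 := sgn_mul_self (a * c)
    have h := substTerm_comm hX hY (symbolMap m n u)
    rw [sub_eq_iff_eq_add] at h
    simp only [envTerm_mul hX, symbolMap_mul, map_add, map_sub,
      starMap_apply, hu', LinearMap.add_apply, substTerm_mul hX, h]
    simp only [glSign_of_mem _ hY, map_smul, smul_mul_assoc, LinearMap.smul_apply]
    match_scalars <;> grind

/-- The right multiplication by `X` in `S(gl(m,n))`, transported to `U(gl(m,n))`. -/
def invStep (m n : ℕ) : gl m n →ₗ[ℂ] Module.End ℂ (EnvAlg m n) :=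
  (LinearMap.mul ℂ (EnvAlg m n)).flip ∘ₗ envι m n - (envTerm m n).flip

lemma invStep_apply (X : gl m n) (u : EnvAlg m n) :
    invStep m n X u = u * envι m n X - envTerm m n u X := rfl

lemma envTerm_comm {a b : ZMod 2} {X Y : gl m n} (hX : X ∈ glPart m n a)
    (hY : Y ∈ glPart m n b) (u : EnvAlg m n) :
    envTerm m n (envTerm m n u X) Y =
      envTerm m n u (X * Y) - sgn (a * b) • envTerm m n u (Y * X) +
        sgn (a * b) • envTerm m n (envTerm m n u Y) X := by
  induction u using env_induction generalizing a b X Y with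
  | one => simp [envTerm_one]
  | smul c x hx =>
    simp only [map_smul, LinearMap.smul_apply]
    rw [hx hX hY]
    simp only [smul_sub, smul_add, smul_comm c]
  | add x y hx hy =>
    simp only [map_add, LinearMap.add_apply]
    rw [hx hX hY, hy hX hY]
    simp only [smul_add]
    abel
  | mul u Z hu =>
    rw [← sub_eq_zero, ← sum_glProj Z]
    simp only [Finset.mul_sum, map_sum, LinearMap.sum_apply, Finset.smul_sum,
      ← Finset.sum_sub_distrib, ← Finset.sum_add_distrib]
    refine Finset.sum_eq_zero fun c _ => ?_
    have hZ := glProj_mem c Z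
    generalize glProj m n c Z = Z at hZ
    have e1 := sgn_mul_self (a * b)
    have e2 := sgn_mul_self (a * c)
    have e3 := sgn_mul_self (b * c)
    have h1 := hu hX hY
    have h2 := hu (mul_mem_glPart hX hZ) hY
    have h3 := hu hX (mul_mem_glPart hY hZ)
    simp only [mul_add, add_mul, sgn_add, mul_comm c b, mul_assoc] at h1 h2 h3
    simp only [envTerm_mul hZ, envTerm_mul (mul_mem_glPart hZ hX),
      envTerm_mul (mul_mem_glPart hZ hY), glSign_of_mem _ hX, glSign_of_mem _ hY, map_add,
      map_sub, LinearMap.add_apply, LinearMap.sub_apply, LinearMap.smul_apply, map_smul,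
      smul_mul_assoc, add_mul, sub_mul, glSign_of_mem _ (mul_mem_glPart hX hY),
      glSign_of_mem _ (mul_mem_glPart hY hX), mul_assoc, h1, h2, h3]
    simp only [mul_add, sgn_add, mul_comm c a, mul_comm c b, mul_comm b a]
    clear hu h1 h2 h3
    match_scalars <;> grind

/-- `invStep` defines an action of `S(gl(m,n))`. -/
lemma invStep_comm {a b : ZMod 2} {X Y : gl m n} (hX : X ∈ glPart m n a)
    (hY : Y ∈ glPart m n b) :
    invStep m n Y * invStep m n X = sgn (a * b) • (invStep m n X * invStep m n Y) := by
  refine LinearMap.ext fun u => ?_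
  have e1 := sgn_mul_self (a * b)
  simp only [Module.End.mul_apply, LinearMap.smul_apply, invStep_apply, map_sub,
    envTerm_mul hX, envTerm_mul hY, glSign_of_mem _ hX, glSign_of_mem _ hY,
    map_smul, smul_mul_assoc, mul_assoc, envTerm_comm hX hY, mul_comm b a,
    envι_swap hX hY, mul_add, mul_sub, mul_smul_comm]
  match_scalars <;> grind

/-- The inverse of `symbolMap`. -/
def symbolInv (m n : ℕ) : SymAlg m n →ₗ[ℂ] EnvAlg m n :=
  LinearMap.applyₗ (1 : EnvAlg m n) ∘ₗ symAct (W := EnvAlg m n) (invStep m n) invStep_comm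

lemma symbolInv_one : symbolInv m n 1 = 1 := by
  simp [symbolInv, symAct_one]

lemma symbolInv_mul (A : SymAlg m n) (X : gl m n) :
    symbolInv m n (A * symι m n X) =
      symbolInv m n A * envι m n X - envTerm m n (symbolInv m n A) X := by
  simp only [symbolInv, LinearMap.comp_apply, LinearMap.applyₗ_apply_apply, symAct_mul,
    invStep_apply]

lemma symbolInv_substTerm (A : SymAlg m n) (Y : gl m n) :
    symbolInv m n (substTerm m n A Y) = envTerm m n (symbolInv m n A) Y := by
  induction A using sym_induction generalizing Y with
  | one => simp [symbolInv_one, envTerm_one, substTerm_one]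
  | smul c x hx => simp only [map_smul, LinearMap.smul_apply, hx]
  | add x y hx hy => simp only [map_add, LinearMap.add_apply, hx, hy]
  | mul A X hA =>
    rw [← sub_eq_zero, ← sum_glProj X, ← sum_glProj Y]
    simp only [Finset.mul_sum, map_sum, LinearMap.sum_apply, ← Finset.sum_sub_distrib]
    refine Finset.sum_eq_zero fun c _ => ?_
    refine Finset.sum_eq_zero fun a _ => ?_
    have hX := glProj_mem a X
    have hY := glProj_mem c Y
    generalize glProj m n a X = X at hX
    generalize glProj m n c Y = Y at hY
    have e1 := sgn_mul_self (a * c)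
    simp only [substTerm_mul hX, symbolInv_mul, map_add, map_sub, LinearMap.sub_apply, hA,
      envTerm_mul hX, envTerm_comm hX hY]
    simp only [glSign_of_mem _ hY, map_smul, smul_mul_assoc, LinearMap.smul_apply]
    match_scalars <;> grind

lemma symbolMap_symbolInv (A : SymAlg m n) : symbolMap m n (symbolInv m n A) = A := by
  induction A using sym_induction with
  | one => rw [symbolInv_one, symbolMap_one]
  | smul c x hx => rw [map_smul, map_smul, hx]
  | add x y hx hy => rw [map_add, map_add, hx, hy]
  | mul A X hA =>
    have h : symbolMap m n (envTerm m n (symbolInv m n A) X) = substTerm m n A X := by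
      have := LinearMap.congr_fun (symbolMap_envTerm (symbolInv m n A)) X
      rwa [hA] at this
    rw [symbolInv_mul, map_sub, symbolMap_mul, h, hA, starMap_apply, add_sub_cancel_right]

lemma symbolInv_symbolMap (u : EnvAlg m n) : symbolInv m n (symbolMap m n u) = u := by
  induction u using env_induction with
  | one => rw [symbolMap_one, symbolInv_one]
  | smul c x hx => rw [map_smul, map_smul, hx]
  | add x y hx hy => rw [map_add, map_add, hx, hy]
  | mul u X hu =>
    rw [symbolMap_mul, starMap_apply, map_add, symbolInv_mul, symbolInv_substTerm, hu,
      sub_add_cancel]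

end envTerm

lemma symbolMap_bijective (m n : ℕ) : Function.Bijective (symbolMap m n) :=
  Function.bijective_iff_has_inverse.mpr
    ⟨symbolInv m n, symbolInv_symbolMap, symbolMap_symbolInv⟩

/-- The special symmetrization `σ : S(gl(m,n)) → U(gl(m,n))`, the inverse of `symbolMap`. -/
def specialSymm (m n : ℕ) : SymAlg m n ≃ₗ[ℂ] EnvAlg m n :=
  (LinearEquiv.ofBijective (symbolMap m n) (symbolMap_bijective m n)).symm

/-! ### The action of `U(gl(m,n))` on the tensor space -/

/-- The tensor space `(ℂ^{m|n})^{⊗N}`. -/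
abbrev TensorSpace (m n N : ℕ) : Type := ⨂[ℂ] _ : Fin N, V m n

/-- The operators which a matrix of parity `a` acting in the `t`-th tensor factor applies to the
other tensor factors: it is carried over the factors to the left of the `t`-th one. -/
def siteSign (m n N : ℕ) (a : ZMod 2) (t : Fin N) : Fin N → V m n →ₗ[ℂ] V m n :=
  fun s => if s < t then vecSign m n a else LinearMap.id

/-- The action in the `t`-th tensor factor, according to the sign rule, of matrices of parity `a`:
`v_1 ⊗ ... ⊗ v_N ↦ (-1)^{a (p(v_1) + ... + p(v_{t-1}))} v_1 ⊗ ... ⊗ X v_t ⊗ ... ⊗ v_N`. -/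
def siteOp (m n N : ℕ) (a : ZMod 2) (t : Fin N) :
    gl m n →ₗ[ℂ] Module.End ℂ (TensorSpace m n N) :=
  (PiTensorProduct.mapMultilinear ℂ (fun _ => V m n) (fun _ => V m n)).toLinearMap
    (siteSign m n N a t) t ∘ₗ (Matrix.toLin' (R := ℂ)).toLinearMap

/-- The action of `gl(m,n)` on the `N`-th tensor power of its vector representation. -/
def tensorGl (m n N : ℕ) : gl m n →ₗ[ℂ] Module.End ℂ (TensorSpace m n N) :=
  ∑ a, ∑ t, siteOp m n N a t ∘ₗ glProj m n a

section tensor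

variable {m n N : ℕ}

lemma siteOp_apply (a : ZMod 2) (t : Fin N) (X : gl m n) :
    siteOp m n N a t X =
      PiTensorProduct.map (Function.update (siteSign m n N a t) t (Matrix.toLin' X)) := rfl

lemma tensorGl_of_mem {a : ZMod 2} {X : gl m n} (hX : X ∈ glPart m n a) :
    tensorGl m n N X = ∑ t, siteOp m n N a t X := by
  rw [tensorGl, LinearMap.sum_apply, Finset.sum_eq_single a]
  · simp [LinearMap.sum_apply, glProj_of_mem hX]
  · intro c _ hc
    simp [LinearMap.sum_apply, glProj_of_mem_ne hX hc]
  · simp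

lemma vecSign_mul (a b : ZMod 2) : vecSign m n a * vecSign m n b = vecSign m n (a + b) := by
  refine LinearMap.ext fun v => ?_
  ext i
  simp [vecSign, add_mul, sgn_add, mul_assoc]

lemma vecSign_toLin {a : ZMod 2} {X : gl m n} (hX : X ∈ glPart m n a) (b : ZMod 2) :
    vecSign m n b * Matrix.toLin' X = sgn (a * b) • (Matrix.toLin' X * vecSign m n b) := by
  refine LinearMap.ext fun v => ?_
  ext i
  simp only [vecSign, Module.End.mul_apply, LinearMap.smul_apply, LinearMap.coe_mk, AddHom.coe_mk,
    Matrix.toLin'_apply, Matrix.mulVec, dotProduct, Pi.smul_apply, smul_eq_mul, Finset.mul_sum]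
  refine Finset.sum_congr rfl fun j _ => ?_
  by_cases h : par i + par j = a
  · have e := sgn_mul_self (b * par j)
    rw [← h, add_mul, sgn_add, mul_comm (par i), mul_comm (par j)]
    linear_combination (-(sgn (b * par i) * X i j * v j)) * e
  · simp [hX i j h]

lemma siteOp_comm {a b : ZMod 2} {X : gl m n} (hX : X ∈ glPart m n a) (Y : gl m n)
    {t u : Fin N} (htu : t < u) :
    siteOp m n N b u Y * siteOp m n N a t X =
      sgn (a * b) • (siteOp m n N a t X * siteOp m n N b u Y) := by
  simp only [siteOp_apply, ← PiTensorProduct.map_mul]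
  set f : Fin N → V m n →ₗ[ℂ] V m n := fun s =>
    Function.update (siteSign m n N a t) t (Matrix.toLin' X) s *
      Function.update (siteSign m n N b u) u (Matrix.toLin' Y) s with hf
  have h : (fun s => Function.update (siteSign m n N b u) u (Matrix.toLin' Y) s *
      Function.update (siteSign m n N a t) t (Matrix.toLin' X) s) =
      Function.update f t (sgn (a * b) • f t) := by
    funext s
    rcases eq_or_ne s t with rfl | hst
    · simp [hf, htu.ne, siteSign, htu, vecSign_toLin hX]
    · rcases eq_or_ne s u with rfl | hsu
      · simp [hf, hst, siteSign, htu.not_gt, ← Module.End.one_eq_id]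
      · by_cases h1 : s < t
        · simp [hf, hst, hsu, siteSign, h1, h1.trans htu, vecSign_mul, add_comm]
        · simp [hf, hst, hsu, siteSign, h1, ← Module.End.one_eq_id]
  rw [h, PiTensorProduct.map_update_smul, Function.update_eq_self]

lemma siteOp_mul (a b : ZMod 2) (X Y : gl m n) (t : Fin N) :
    siteOp m n N a t X * siteOp m n N b t Y = siteOp m n N (a + b) t (X * Y) := by
  simp only [siteOp_apply, ← PiTensorProduct.map_mul]
  congr 1
  funext s
  rcases eq_or_ne s t with rfl | hst
  · simp [Matrix.toLin'_mul, Module.End.mul_eq_comp]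
  · by_cases h1 : s < t
    · simp [hst, siteSign, h1, vecSign_mul]
    · simp [hst, siteSign, h1, ← Module.End.one_eq_id]

lemma tensorGl_comm {a b : ZMod 2} {X Y : gl m n} (hX : X ∈ glPart m n a)
    (hY : Y ∈ glPart m n b) :
    tensorGl m n N X * tensorGl m n N Y = sgn (a * b) • (tensorGl m n N Y * tensorGl m n N X) +
      tensorGl m n N (X * Y - sgn (a * b) • (Y * X)) := by
  have hYX : Y * X ∈ glPart m n (a + b) := add_comm b a ▸ mul_mem_glPart hY hX
  have hb : (X * Y - sgn (a * b) • (Y * X)) ∈ glPart m n (a + b) :=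
    Submodule.sub_mem _ (mul_mem_glPart hX hY) (Submodule.smul_mem _ _ hYX)
  rw [tensorGl_of_mem hX, tensorGl_of_mem hY, tensorGl_of_mem hb, Finset.sum_mul_sum,
    Finset.sum_mul_sum, Finset.sum_comm (f := fun u t => siteOp m n N b u Y * siteOp m n N a t X),
    Finset.smul_sum, ← Finset.sum_add_distrib]
  refine Finset.sum_congr rfl fun t _ => ?_
  rw [← Finset.sum_erase_add _ _ (Finset.mem_univ t), ← Finset.sum_erase_add
    (f := fun u => siteOp m n N b u Y * siteOp m n N a t X) _ (Finset.mem_univ t), smul_add,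
    add_assoc]
  congr 1
  · rw [Finset.smul_sum]
    refine Finset.sum_congr rfl fun u hut => ?_
    rcases lt_or_gt_of_ne (Finset.ne_of_mem_erase hut) with h | h
    · rw [siteOp_comm hY X h, mul_comm b a]
    · rw [siteOp_comm hX Y h, smul_smul, sgn_mul_self, one_smul]
  · rw [siteOp_mul, siteOp_mul, add_comm b a, ← map_smul, ← map_add, add_sub_cancel]

end tensor

/-- The action of `U(gl(m,n))` on the tensor space `(ℂ^{m|n})^{⊗N}`. -/
def envTensor (m n N : ℕ) : EnvAlg m n →ₐ[ℂ] Module.End ℂ (TensorSpace m n N) :=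
  envLift (tensorGl m n N) tensorGl_comm

/-! ### The action of `ℂ[S_N]` on the tensor space -/

/-- The sign `c(q, τ)` which appears when odd variables are permuted: for supercommuting variables
`y_1, ..., y_N` of parities `q` one has
`y_1 ... y_N = c(q, τ) y_{τ⁻¹(1)} ... y_{τ⁻¹(N)}`. -/
def permSign {N : ℕ} (q : Fin N → ZMod 2) (τ : Equiv.Perm (Fin N)) : ℂ :=
  ∏ j, ∏ i ∈ Finset.Iio j, if τ j < τ i then sgn (q i * q j) else 1

/-- The action of a permutation on the tensor space: for homogeneous vectors of parities `q`,
`v_1 ⊗ ... ⊗ v_N ↦ c(q, τ) v_{τ⁻¹(1)} ⊗ ... ⊗ v_{τ⁻¹(N)}`. -/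
def permOp (m n N : ℕ) (τ : Equiv.Perm (Fin N)) : Module.End ℂ (TensorSpace m n N) :=
  ∑ q : Fin N → ZMod 2, permSign q τ •
    ((PiTensorProduct.reindex ℂ (fun _ => V m n) τ).toLinearMap ∘ₗ
      PiTensorProduct.map fun i => vecProj m n (q i))

section perm

variable {m n N : ℕ}

lemma vecProj_eq {a b : ZMod 2} {v : V m n} (hv : ∀ i, par i ≠ a → v i = 0) :
    vecProj m n b v = if b = a then v else 0 := by
  ext i
  by_cases h : par i = a
  · by_cases hb : b = a
    · simp [vecProj, h, hb]
    · simp [vecProj, h, hb, Ne.symm hb]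
  · by_cases hb : b = a <;> simp [vecProj, hv i h, hb]

lemma permOp_tprod (τ : Equiv.Perm (Fin N)) (q : Fin N → ZMod 2) (v : Fin N → V m n)
    (hv : ∀ t i, par i ≠ q t → v t i = 0) :
    permOp m n N τ (PiTensorProduct.tprod ℂ v) =
      permSign q τ • PiTensorProduct.tprod ℂ fun t => v (τ⁻¹ t) := by
  rw [permOp, LinearMap.sum_apply, Finset.sum_eq_single q]
  · have : (fun i => vecProj m n (q i) (v i)) = v := by
      funext i
      rw [vecProj_eq (hv i), if_pos rfl]
    simp only [LinearMap.smul_apply, LinearMap.comp_apply, PiTensorProduct.map_tprod, this]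
    congr 1
    exact PiTensorProduct.reindex_tprod _ _
  · intro q' _ hq
    obtain ⟨t, ht⟩ := Function.ne_iff.mp hq
    have : PiTensorProduct.tprod ℂ (fun i => vecProj m n (q' i) (v i)) = 0 :=
      (PiTensorProduct.tprod ℂ).map_coord_zero t (by
        rw [vecProj_eq (hv t), if_neg ht])
    simp only [LinearMap.smul_apply, LinearMap.comp_apply, PiTensorProduct.map_tprod, this,
      map_zero, smul_zero]
  · simp

lemma permSign_one (q : Fin N → ZMod 2) : permSign q 1 = 1 := by
  refine Finset.prod_eq_one fun j _ => Finset.prod_eq_one fun i hi => ?_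
  rw [if_neg]
  simpa using (Finset.mem_Iio.mp hi).le

lemma permSign_mul (q : Fin N → ZMod 2) (τ σ : Equiv.Perm (Fin N)) :
    permSign q (τ * σ) = permSign q σ * permSign (fun t => q (σ⁻¹ t)) τ := by
  -- compare antisymmetric products over all pairs before and after renumbering by `σ`
  set g : Fin N → Fin N → ℂ := fun i j =>
    (if i < j then 1 else if j < i then -1 else 0) with hg
  set f : Fin N → Fin N → ℂ := fun i j => g i j *
    (if (i < j ∧ τ j < τ i) ∨ (j < i ∧ τ i < τ j) then sgn (q (σ⁻¹ i) * q (σ⁻¹ j)) else 1) with hf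
  have hganti : ∀ i j, g i j = -g j i := by
    intro i j
    rcases lt_trichotomy i j with h | h | h
    · simp [hg, h, h.not_gt]
    · simp [hg, h]
    · simp [hg, h, h.not_gt]
  have hfanti : ∀ i j, f i j = -f j i := by
    intro i j
    simp only [hf]
    rw [hganti i j, mul_comm (q (σ⁻¹ j)), neg_mul]
    congr 3
    rw [or_comm]
  have h1 := σ.prod_Iio_comp_eq_sign_mul_prod hganti
  have h2 := σ.prod_Iio_comp_eq_sign_mul_prod hfanti
  have hg1 : ∏ j, ∏ i ∈ Finset.Iio j, g i j = 1 :=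
    Finset.prod_eq_one fun j _ => Finset.prod_eq_one fun i hi => by
      simp [hg, Finset.mem_Iio.mp hi]
  have hf1 : ∏ j, ∏ i ∈ Finset.Iio j, f i j = permSign (fun t => q (σ⁻¹ t)) τ := by
    refine Finset.prod_congr rfl fun j _ => Finset.prod_congr rfl fun i hi => ?_
    have hi := Finset.mem_Iio.mp hi
    simp [hf, hg, hi, hi.not_gt]
  rw [hg1, mul_one] at h1
  rw [hf1, ← h1] at h2
  have hne : ∏ j, ∏ i ∈ Finset.Iio j, g (σ i) (σ j) ≠ 0 := by
    rw [h1]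
    rcases Int.units_eq_one_or (Equiv.Perm.sign σ) with h | h <;> simp [h]
  apply mul_left_cancel₀ hne
  rw [mul_left_comm, ← h2, permSign, permSign, ← Finset.prod_mul_distrib,
    ← Finset.prod_mul_distrib]
  refine Finset.prod_congr rfl fun j _ => ?_
  rw [← Finset.prod_mul_distrib, ← Finset.prod_mul_distrib]
  refine Finset.prod_congr rfl fun i hi => ?_
  have hi := Finset.mem_Iio.mp hi
  have hs := sgn_mul_self (q i * q j)
  have hσ : σ i ≠ σ j := fun h => hi.ne (σ.injective h)
  have hτ : τ (σ i) ≠ τ (σ j) := fun h => hσ (τ.injective h)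
  have hinv : ∀ x, σ⁻¹ (σ x) = x := σ.symm_apply_apply
  simp only [hf, Equiv.Perm.mul_apply, hinv]
  rcases lt_or_gt_of_ne hσ with h | h <;> rcases lt_or_gt_of_ne hτ with h' | h' <;>
    simp [h, h', h.not_gt, h'.not_gt] <;>
    first | ring1 | linear_combination (-(g (σ i) (σ j))) * hs

lemma permOp_mul (τ σ : Equiv.Perm (Fin N)) :
    permOp m n N (τ * σ) = permOp m n N τ * permOp m n N σ := by
  refine PiTensorProduct.ext ?_
  refine Module.Basis.ext_multilinear (fun _ => Pi.basisFun ℂ (Idx m n)) fun w => ?_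
  have hv : ∀ (w : Fin N → Idx m n) t i, par i ≠ par (w t) →
      (Pi.basisFun ℂ (Idx m n) (w t) : V m n) i = 0 := by
    intro w t i h
    have : i ≠ w t := fun h' => h (by rw [h'])
    simp [this]
  simp only [LinearMap.compMultilinearMap_apply, Module.End.mul_apply]
  rw [permOp_tprod (τ * σ) (fun t => par (w t)) _ (hv w),
    permOp_tprod σ (fun t => par (w t)) _ (hv w), map_smul,
    permOp_tprod τ (fun t => par (w (σ⁻¹ t))) _ (hv fun t => w (σ⁻¹ t)), smul_smul, permSign_mul]
  rfl

lemma permOp_one : permOp m n N 1 = 1 := by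
  refine PiTensorProduct.ext ?_
  refine Module.Basis.ext_multilinear (fun _ => Pi.basisFun ℂ (Idx m n)) fun w => ?_
  simp only [LinearMap.compMultilinearMap_apply, Module.End.one_apply]
  rw [permOp_tprod 1 (fun t => par (w t)), permSign_one, one_smul]
  · rfl
  · intro t i h
    have : i ≠ w t := fun h' => h (by rw [h'])
    simp [this]

end perm

/-- The representation `π` of `ℂ[S_N]` on the tensor space `(ℂ^{m|n})^{⊗N}`. -/
def permTensor (m n N : ℕ) :
    MonoidAlgebra ℂ (Equiv.Perm (Fin N)) →ₐ[ℂ] Module.End ℂ (TensorSpace m n N) :=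
  MonoidAlgebra.lift ℂ _ _
    { toFun := permOp m n N
      map_one' := permOp_one
      map_mul' := permOp_mul }

/-! ### The central elements -/

/-- The parts `ρ_1 ≥ ρ_2 ≥ ... ≥ ρ_l` of a partition. -/
def partList {k : ℕ} (ρ : Nat.Partition k) : List ℕ := ρ.parts.sort (· ≥ ·)

/-- The element `a_{ρ,N}` of `ℂ[S_N]`: the sum of the permutations
`(i_1, ..., i_{ρ_1}) (i_{ρ_1+1}, ..., i_{ρ_1+ρ_2}) ...` over all sequences of pairwise distinct
numbers `i_1, ..., i_{|ρ|}` in `{1, ..., N}`. The sequence is split into blocks of lengths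
`ρ_1, ..., ρ_l`, that is, it is indexed by the pairs of a number `j` of a part and a position in
this part; `List.formPerm [a, b, ..., z]` is the cyclic permutation `a → b → ... → z → a`. -/
def cycleSum {k : ℕ} (ρ : Nat.Partition k) (N : ℕ) : MonoidAlgebra ℂ (Equiv.Perm (Fin N)) :=
  ∑ i : (Σ j : Fin (partList ρ).length, Fin ((partList ρ).get j)) ↪ Fin N,
    MonoidAlgebra.of ℂ (Equiv.Perm (Fin N))
      (List.ofFn fun j => (List.ofFn fun t => i ⟨j, t⟩).formPerm).prod

/-- The matrix unit `E_{ij}` as an element of `S(gl(m,n))`. -/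
def symE {m n : ℕ} (i j : Idx m n) : SymAlg m n := symι m n (Matrix.single i j 1)

/-- The element `I_k = ∑ (-1)^{p(i_2) + ... + p(i_k)} E_{i_1 i_2} E_{i_2 i_3} ... E_{i_k i_1}` of
`S(gl(m,n))`, where `k ≥ 1`; the sum is over all `i_1, ..., i_k`, numbered here from `0`, and
`finRotate k` is the cyclic shift `0 → 1 → ... → k - 1 → 0`. -/
def cycleElt (m n k : ℕ) : SymAlg m n :=
  ∑ i : Fin k → Idx m n,
    sgn (∑ t with t.val ≠ 0, par (i t)) •
      (List.ofFn fun t => symE (i t) (i (finRotate k t))).prod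

/-- The element `I_ρ = I_{ρ_1} ... I_{ρ_l}` of `S(gl(m,n))`. -/
def cycleProd (m n : ℕ) {k : ℕ} (ρ : Nat.Partition k) : SymAlg m n :=
  ((partList ρ).map (cycleElt m n)).prod

end SuperSchurWeyl

end

open scoped TensorProduct

noncomputable section

namespace SuperSchurWeyl

/-! ### Matrices acting at a single tensor factor -/

section siteGl

variable {m n N : ℕ}

/-! Write `X^(t)` for the action of `X` at the site `t` with the sign rule (`siteGl`). Homogeneous
operators at distinct sites supercommute, at one site they multiply as matrices, and `X` acts on the
whole tensor space by `∑_t X^(t)`.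

The special symmetrization is the one for which `σ(Y_1 ⋯ Y_k)` acts by the sum of `Y_1^(t_1) ⋯
Y_k^(t_k)` over all pairwise distinct sites (`envTensor_specialSymm_monomial`). Indeed, multiply
such a sum on the right by `∑_u X^(u)`. The terms with a new site `u` give the sum for `Y_1, ...,
Y_k, X`. In the terms with `u = t_r` the operator `X^(u)` moves left to `Y_r^(t_r)`, picking up the
sign `(-1)^{P(r)}`, and merges with it into `(Y_r X)^(t_r)`. These are the terms in the definition
of `*` (`siteSum_mul_tensorGl`).

On the other side, the super transposition of the sites `a` and `b` is `∑_{i,j} (-1)^{p(j)} E_ij^(a)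
E_ji^(b)` (`permOp_swap`). A cycle is a product of transpositions of consecutive entries; matrix
units meeting at a common site contract, and the cycle `(t_1, ..., t_r)` becomes the sum of `E_{i_1
i_2}^(t_1) ⋯ E_{i_r i_1}^(t_r)` with the signs of `I_r` (`permOp_formPerm_ofFn`). Multiplying over
the blocks of `ρ` and summing over the sequences of distinct sites yields the action of `σ(I_ρ)`.

Centrality holds because conjugation by `τ` replaces the sequence `(i_1, ..., i_k)` by `(τ(i_1),
..., τ(i_k))`, which permutes the terms of `a_{ρ,N}`. -/

/-- The action of `gl(m,n)` in the `t`-th tensor factor, according to the sign rule. -/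
def siteGl (m n N : ℕ) (t : Fin N) : gl m n →ₗ[ℂ] Module.End ℂ (TensorSpace m n N) :=
  ∑ a, siteOp m n N a t ∘ₗ glProj m n a

lemma siteGl_of_mem {a : ZMod 2} {X : gl m n} (hX : X ∈ glPart m n a) (t : Fin N) :
    siteGl m n N t X = siteOp m n N a t X := by
  rw [siteGl, LinearMap.sum_apply, Finset.sum_eq_single a]
  · simp [glProj_of_mem hX]
  · intro c _ hc
    simp [glProj_of_mem_ne hX hc]
  · simp

lemma tensorGl_eq_sum_siteGl (X : gl m n) : tensorGl m n N X = ∑ t, siteGl m n N t X := by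
  simp only [tensorGl, siteGl, LinearMap.sum_apply]
  exact Finset.sum_comm

lemma siteGl_mul {a b : ZMod 2} {X Y : gl m n} (hX : X ∈ glPart m n a) (hY : Y ∈ glPart m n b)
    (t : Fin N) : siteGl m n N t X * siteGl m n N t Y = siteGl m n N t (X * Y) := by
  rw [siteGl_of_mem hX, siteGl_of_mem hY, siteGl_of_mem (mul_mem_glPart hX hY), siteOp_mul]

lemma siteGl_comm {a b : ZMod 2} {X Y : gl m n} (hX : X ∈ glPart m n a) (hY : Y ∈ glPart m n b)
    {t u : Fin N} (htu : t ≠ u) :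
    siteGl m n N u Y * siteGl m n N t X =
      sgn (a * b) • (siteGl m n N t X * siteGl m n N u Y) := by
  rw [siteGl_of_mem hX, siteGl_of_mem hY]
  rcases lt_or_gt_of_ne htu with h | h
  · exact siteOp_comm hX Y h
  · rw [siteOp_comm hY X h, smul_smul, mul_comm b a, sgn_mul_self, one_smul]

/-- The identity matrix is even, so no sign is carried over the factors to the left. This handles
cycles of length one, where `∑_i E_ii^(t)` must be the identity. -/
lemma siteGl_one (t : Fin N) : siteGl m n N t 1 = 1 := by
  have h1 : (1 : gl m n) ∈ glPart m n 0 := by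
    intro i j h
    refine Matrix.one_apply_ne fun hij => h ?_
    rw [hij, CharTwo.add_self_eq_zero]
  rw [siteGl_of_mem h1, siteOp_apply, ← PiTensorProduct.map_one]
  congr 1
  funext s
  rcases eq_or_ne s t with rfl | hst
  · simp [Module.End.one_eq_id]
  · simp only [ne_eq, hst, not_false_eq_true, Function.update_of_ne, siteSign]
    split_ifs
    · refine LinearMap.ext fun v => ?_
      ext i
      simp [vecSign, sgn_zero]
    · rfl

/-- Moving the action in the `r₀`-th of several distinct tensor factors into its place. -/
lemma prod_siteGl_mul_siteGl {k : ℕ} (Y : Fin k → gl m n) (q : Fin k → ZMod 2)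
    (hY : ∀ r, Y r ∈ glPart m n (q r)) {b : ZMod 2} {X : gl m n} (hX : X ∈ glPart m n b)
    {t : Fin k → Fin N} (ht : Function.Injective t) (r₀ : Fin k) :
    (List.ofFn fun r => siteGl m n N (t r) (Y r)).prod * siteGl m n N (t r₀) X =
      sgn (∑ s ∈ Finset.Ioi r₀, q s * b) •
        (List.ofFn fun s => siteGl m n N (t s) (if s = r₀ then Y s * X else Y s)).prod := by
  induction k with
  | zero => exact r₀.elim0
  | succ k ih =>
    have hne (r : Fin k) : Fin.last k ≠ r.castSucc := (Fin.castSucc_lt_last r).ne'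
    have hne' (r : Fin k) : r.castSucc ≠ Fin.last k := (Fin.castSucc_lt_last r).ne
    have hI (r : Fin k) : Finset.Ioi r.castSucc =
        insert (Fin.last k) ((Finset.Ioi r).map Fin.castSuccEmb) := by
      ext s
      induction s using Fin.lastCases with
      | last => simp [Fin.castSucc_lt_last]
      | cast s => simp [Fin.le_last]
    have hI' : Finset.Ioi (Fin.last k) = ∅ := by
      ext s
      simp [Fin.le_last]
    simp only [List.ofFn_succ', List.concat_eq_append, List.prod_append, List.prod_singleton]
    -- Either `X` already stands next to the factor at its site, or it passes the last factor, which
    -- sits at another site and contributes one summand of the sign.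
    induction r₀ using Fin.lastCases with
    | last => simp [hI', hne', sgn_zero, mul_assoc, siteGl_mul (hY _) hX]
    | cast r =>
      have hS : ∑ s ∈ Finset.Ioi r.castSucc, q s * b =
          q (Fin.last k) * b + ∑ s ∈ Finset.Ioi r, q s.castSucc * b := by
        rw [hI, Finset.sum_insert (by simp), Finset.sum_map]
        rfl
      have htr : t r.castSucc ≠ t (Fin.last k) := fun h => hne' r (ht h)
      rw [mul_assoc, siteGl_comm hX (hY _) htr, mul_smul_comm, ← mul_assoc,
        ih (t := fun r => t r.castSucc) (fun r => Y r.castSucc) (fun r => q r.castSucc)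
          (fun r => hY _) (ht.comp (Fin.castSucc_injective k)), hS, mul_comm b]
      simp [hne, sgn_add, smul_smul]

/-! ### Sums over pairwise distinct sites -/

/-- The sum over all pairwise distinct sites of the products of the operators `Y_r` acting at
these sites. -/
def siteSum (m n N : ℕ) {k : ℕ} (Y : Fin k → gl m n) : Module.End ℂ (TensorSpace m n N) :=
  ∑ t : Fin k → Fin N with Function.Injective t,
    (List.ofFn fun r => siteGl m n N (t r) (Y r)).prod

lemma sum_snoc_injective {M : Type*} [AddCommMonoid M] {α : Type*} [Fintype α] [DecidableEq α]
    {k : ℕ} (f : (Fin (k + 1) → α) → M) :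
    ∑ t : Fin (k + 1) → α with Function.Injective t, f t =
      ∑ t : Fin k → α with Function.Injective t,
        ∑ u with u ∉ Set.range t, f (Fin.snoc t u) := by
  classical
  simp only [Finset.sum_filter]
  rw [← (Fin.snocEquiv fun _ => α).sum_comp, Fintype.sum_prod_type_right]
  refine Finset.sum_congr rfl fun t _ => ?_
  simp only [Fin.snocEquiv, Equiv.coe_fn_mk, Fin.snoc_injective_iff]
  by_cases ht : Function.Injective t <;> simp [ht]

/-- The sum over all sites `u` of `X` is split according to whether `u` is one of the sites already
occupied. The result has the shape of the definition of `*`, with `siteSum` in place of monomials.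
-/
lemma siteSum_mul_tensorGl {k : ℕ} (Y : Fin k → gl m n) (q : Fin k → ZMod 2)
    (hY : ∀ r, Y r ∈ glPart m n (q r)) {b : ZMod 2} {X : gl m n} (hX : X ∈ glPart m n b) :
    siteSum m n N Y * tensorGl m n N X =
      siteSum m n N (Fin.snoc Y X : Fin (k + 1) → gl m n) +
        ∑ r, sgn (∑ s ∈ Finset.Ioi r, q s * b) •
          siteSum m n N fun s => if s = r then Y s * X else Y s := by
  classical
  -- The correction terms are the contributions of the occupied sites `u = t r`.
  have hr : ∑ r, sgn (∑ s ∈ Finset.Ioi r, q s * b) •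
        (siteSum m n N fun s => if s = r then Y s * X else Y s) =
      ∑ t : Fin k → Fin N with Function.Injective t,
        ∑ r, (List.ofFn fun r => siteGl m n N (t r) (Y r)).prod * siteGl m n N (t r) X := by
    rw [Finset.sum_comm]
    refine Finset.sum_congr rfl fun r _ => ?_
    rw [siteSum, Finset.smul_sum]
    refine Finset.sum_congr rfl fun t ht => ?_
    exact (prod_siteGl_mul_siteGl Y q hY hX (Finset.mem_filter.mp ht).2 r).symm
  rw [hr, siteSum, siteSum, sum_snoc_injective, ← Finset.sum_add_distrib, Finset.sum_mul,
    tensorGl_eq_sum_siteGl]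
  refine Finset.sum_congr rfl fun t ht => ?_
  have ht := (Finset.mem_filter.mp ht).2
  rw [Finset.mul_sum, ← Finset.sum_filter_not_add_sum_filter (p := fun u => u ∈ Set.range t)]
  congr 1
  · refine Finset.sum_congr rfl fun u _ => ?_
    simp only [List.ofFn_succ', List.concat_eq_append, List.prod_append, List.prod_singleton,
      Fin.snoc_castSucc, Fin.snoc_last]
  -- Since `t` is injective, each occupied site is `t r` for exactly one `r`.
  · rw [← Finset.sum_image (s := Finset.univ) (g := t)
      (f := fun u => (List.ofFn fun r => siteGl m n N (t r) (Y r)).prod * siteGl m n N u X)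
      ht.injOn]
    refine Finset.sum_congr ?_ fun _ _ => rfl
    ext u
    simp

/-! ### The special symmetrization on the tensor space -/

lemma specialSymm_apply (A : SymAlg m n) : specialSymm m n A = symbolInv m n A := by
  rw [specialSymm, LinearEquiv.symm_apply_eq]
  exact (symbolMap_symbolInv A).symm

lemma envTensor_ι (X : gl m n) : envTensor m n N (envι m n X) = tensorGl m n N X :=
  envLift_ι _ _ X

/-- The special symmetrization of a monomial acts by the sum over distinct sites. -/
lemma envTensor_specialSymm_monomial {k : ℕ} (Y : Fin k → gl m n) (q : Fin k → ZMod 2)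
    (hY : ∀ r, Y r ∈ glPart m n (q r)) :
    envTensor m n N (specialSymm m n (List.ofFn fun r => symι m n (Y r)).prod) =
      siteSum m n N Y := by
  rw [specialSymm_apply]
  induction k with
  | zero =>
    rw [siteSum, Finset.filter_true_of_mem fun t _ => Function.injective_of_subsingleton t]
    simp [symbolInv_one]
  | succ k ih =>
    obtain ⟨Y, X, rfl⟩ : ∃ (Y' : Fin k → gl m n) (X : gl m n), Y = Fin.snoc Y' X :=
      ⟨Fin.init Y, Y (Fin.last k), (Fin.snoc_init_self Y).symm⟩
    have hY' (r : Fin k) : Y r ∈ glPart m n (q r.castSucc) := by simpa using hY r.castSucc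
    have hX : X ∈ glPart m n (q (Fin.last k)) := by simpa using hY (Fin.last k)
    have hs := starMap_monomial Y (fun r => q r.castSucc) hY' hX
    -- Cancelling the leading term `A X` leaves a formula for `substTerm` on monomials.
    rw [starMap_apply, add_right_inj] at hs
    simp only [List.ofFn_succ', List.concat_eq_append, List.prod_append, List.prod_singleton,
      Fin.snoc_castSucc, Fin.snoc_last]
    -- With `A = Y_1 ⋯ Y_k` one has `σ(A X) = σ(A) X - σ(A * X - A X)`. The correction is a
    -- combination of monomials with `k` factors, so the induction hypothesis applies to it as well
    -- as to `A`.
    rw [symbolInv_mul, ← symbolInv_substTerm, hs, map_sub, map_mul, envTensor_ι,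
      ih Y _ hY', siteSum_mul_tensorGl Y _ hY' hX]
    simp only [map_sum, map_smul]
    rw [sub_eq_iff_eq_add]
    congr 1
    refine Finset.sum_congr rfl fun r _ => ?_
    congr 1
    refine (ih _ (fun s => if s = r then q s.castSucc + q (Fin.last k) else q s.castSucc)
      fun s => ?_).symm
    split_ifs
    · exact mul_mem_glPart (hY' s) hX
    · exact hY' s

/-- The special symmetrization of a monomial whose factors are indexed by a finite type. -/
lemma envTensor_specialSymm_prod {ι : Type*} [Fintype ι] [DecidableEq ι] {L : List ι}
    (hL : L.Nodup) (hmem : ∀ x, x ∈ L) (Y : ι → gl m n) (q : ι → ZMod 2)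
    (hY : ∀ x, Y x ∈ glPart m n (q x)) :
    envTensor m n N (specialSymm m n (L.map fun x => symι m n (Y x)).prod) =
      ∑ e : ι ↪ Fin N, (L.map fun x => siteGl m n N (e x) (Y x)).prod := by
  classical
  have hmap {M : Type} (f : ι → M) : L.map f = List.ofFn fun r => f (L.get r) := by
    simp [List.ofFn_getElem_eq_map]
  simp only [hmap]
  rw [envTensor_specialSymm_monomial _ _ fun r => hY (L.get r), siteSum]
  -- The list enumerates the index type without repetition, so embeddings of that type correspond to
  -- injective sequences of sites.
  let φ := hL.getEquivOfForallMemList L hmem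
  symm
  refine Finset.sum_bij (fun (e : ι ↪ Fin N) _ => e ∘ φ) ?_ ?_ ?_ ?_
  · intro e _
    simpa using e.injective
  · intro e _ e' _ h
    exact DFunLike.coe_injective (φ.surjective.injective_comp_right h)
  · intro t ht
    refine ⟨φ.symm.toEmbedding.trans ⟨t, by simpa using ht⟩, Finset.mem_univ _, ?_⟩
    funext r
    simp
  · intro e _
    rfl

end siteGl

/-! ### Ordered products, conjugation of cycles and centrality -/

lemma mul_formPerm_mul_inv {α : Type*} [DecidableEq α] (τ : Equiv.Perm α) (l : List α) :
    τ * l.formPerm * τ⁻¹ = (l.map τ).formPerm := by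
  induction l with
  | nil => simp
  | cons x l ih =>
    cases l with
    | nil => simp
    | cons y l =>
      rw [List.map_cons, List.map_cons, List.formPerm_cons_cons, List.formPerm_cons_cons,
        ← List.map_cons, ← ih, Equiv.swap_apply_apply]
      group

lemma sum_prod_ofFn {A : Type*} [Semiring A] {l : ℕ} {ι : Fin l → Type*}
    [∀ j, Fintype (ι j)] (f : ∀ j, ι j → A) :
    (List.ofFn fun j => ∑ x, f j x).prod =
      ∑ x : ∀ j, ι j, (List.ofFn fun j => f j (x j)).prod := by
  induction l with
  | zero => simp
  | succ l ih =>
    rw [← (Fin.consEquiv ι).sum_comp, Fintype.sum_prod_type]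
    simp only [List.ofFn_succ, List.prod_cons, ih, Finset.sum_mul_sum]
    rfl

lemma prod_ofFn_smul {A : Type*} [Semiring A] [Algebra ℂ A] {l : ℕ} (c : Fin l → ℂ)
    (f : Fin l → A) :
    (List.ofFn fun j => c j • f j).prod = (∏ j, c j) • (List.ofFn f).prod := by
  induction l with
  | zero => simp
  | succ l ih =>
    simp only [List.ofFn_succ, List.prod_cons, ih, Fin.prod_univ_succ, smul_mul_smul_comm]

/-- Passes between one long monomial, to which the symmetrization formula applies, and its grouping
into the blocks of a partition; the order of the factors is kept, as they need not commute. -/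
lemma prod_map_sigma {A : Type*} [Monoid A] {l : ℕ} {r : Fin l → ℕ}
    (f : (Σ j : Fin l, Fin (r j)) → A) :
    (((List.finRange l).sigma fun j => List.finRange (r j)).map f).prod =
      (List.ofFn fun j => (List.ofFn fun t => f ⟨j, t⟩).prod).prod := by
  simp only [List.ofFn_eq_map]
  induction List.finRange l with
  | nil => simp
  | cons j L ih => simp [List.sigma_cons, ih, Function.comp_def]

lemma cycleSum_mem_center {k : ℕ} (ρ : Nat.Partition k) (N : ℕ) :
    cycleSum ρ N ∈ Subalgebra.center ℂ (MonoidAlgebra ℂ (Equiv.Perm (Fin N))) := by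
  have key (τ : Equiv.Perm (Fin N)) :
      MonoidAlgebra.of ℂ _ τ * cycleSum ρ N = cycleSum ρ N * MonoidAlgebra.of ℂ _ τ := by
    rw [cycleSum, Finset.mul_sum, Finset.sum_mul]
    let φ : ((Σ j : Fin (partList ρ).length, Fin ((partList ρ).get j)) ↪ Fin N) ≃ _ :=
      Equiv.embeddingCongr (Equiv.refl _) τ
    -- Reindexing one side by `i ↦ τ ∘ i` makes the two sums agree term by term.
    rw [← φ.sum_comp (fun i => _ * MonoidAlgebra.of ℂ _ τ)]
    refine Finset.sum_congr rfl fun i _ => ?_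
    rw [← map_mul, ← map_mul]
    congr 1
    rw [← mul_inv_eq_iff_eq_mul, ← MulAut.conj_apply, map_list_prod, List.map_ofFn]
    congr 2
    funext j
    simp only [Function.comp_apply, MulAut.conj_apply, mul_formPerm_mul_inv, List.map_ofFn]
    rfl
  rw [Subalgebra.mem_center_iff]
  intro x
  induction x using MonoidAlgebra.induction_on with
  | of τ => exact key τ
  | add x y hx hy => rw [add_mul, mul_add, hx, hy]
  | smul c x hx => rw [smul_mul_assoc, mul_smul_comm, hx]

/-! ### The super transposition in terms of matrix units -/

section swap

variable {m n N : ℕ}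

lemma single_mem_glPart (i j : Idx m n) : Matrix.single i j (1 : ℂ) ∈ glPart m n (par i + par j) := by
  intro k l h
  refine Matrix.single_apply_of_ne i j 1 k l ?_
  rintro ⟨rfl, rfl⟩
  exact h rfl

/-- The standard basis of the tensor space. -/
def basisTensor (w : Fin N → Idx m n) : TensorSpace m n N :=
  PiTensorProduct.tprod ℂ fun t => Pi.single (w t) 1

lemma end_ext {f g : Module.End ℂ (TensorSpace m n N)}
    (h : ∀ w, f (basisTensor w) = g (basisTensor w)) : f = g := by
  refine PiTensorProduct.ext ?_
  refine Module.Basis.ext_multilinear (fun _ => Pi.basisFun ℂ (Idx m n)) fun w => ?_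
  simpa [basisTensor] using h w

lemma permOp_basisTensor (τ : Equiv.Perm (Fin N)) (w : Fin N → Idx m n) :
    permOp m n N τ (basisTensor w) =
      permSign (fun t => par (w t)) τ • basisTensor fun t => w (τ⁻¹ t) := by
  refine permOp_tprod τ (fun t => par (w t)) _ fun t i h => ?_
  have : i ≠ w t := fun h' => h (by rw [h'])
  simp [this]

/-- The sign comes from carrying `E_ij`, of parity `p(i) + p(j)`, over the basis vectors to the left
of `t`. -/
lemma siteGl_single_basisTensor (i j : Idx m n) (t : Fin N) (w : Fin N → Idx m n) :
    siteGl m n N t (Matrix.single i j 1) (basisTensor w) =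
      if w t = j then (∏ s ∈ Finset.Iio t, sgn ((par i + par j) * par (w s))) •
        basisTensor (Function.update w t i) else 0 := by
  rw [siteGl_of_mem (single_mem_glPart i j), siteOp_apply, basisTensor,
    PiTensorProduct.map_tprod]
  split_ifs with h
  · have : (fun s => Function.update (siteSign m n N (par i + par j) t) t
        (Matrix.toLin' (Matrix.single i j 1)) s (Pi.single (w s) 1)) = fun s =>
        (if s < t then sgn ((par i + par j) * par (w s)) else 1) •
          (Pi.single (Function.update w t i s) 1 : V m n) := by
      funext s
      rcases eq_or_ne s t with rfl | hst
      · subst h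
        ext k
        simp [Matrix.single_apply, Pi.single_apply, eq_comm]
      · by_cases hs : s < t
        · ext k
          rcases eq_or_ne k (w s) with rfl | hk
          · simp [hst, siteSign, hs, vecSign]
          · simp [hst, siteSign, hs, vecSign, hk]
        · simp [hst, siteSign, hs]
    rw [this, MultilinearMap.map_smul_univ, basisTensor, ← Finset.prod_filter]
    congr 2
    ext s
    simp
  · refine (PiTensorProduct.tprod ℂ).map_coord_zero t ?_
    ext k
    simp [Ne.symm h]

/-- The pairs inverted by the transposition are `(a, b)` and, for each `s` strictly between, `(a,
s)` and `(s, b)`. -/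
lemma permSign_swap (q : Fin N → ZMod 2) {a b : Fin N} (hab : a < b) :
    permSign q (Equiv.swap a b) = sgn (q a * q b) *
      ∏ s ∈ Finset.Ioo a b, sgn ((q a + q b) * q s) := by
  -- The inversions are grouped by their larger element `j`: for `j = b` the smaller one runs over
  -- `[a, b)`, for `a < j < b` it is `a`, and otherwise there is none.
  have hinner (j : Fin N) :
      (∏ i ∈ Finset.Iio j, if Equiv.swap a b j < Equiv.swap a b i then sgn (q i * q j) else 1) =
        if j = b then ∏ i ∈ Finset.Ico a b, sgn (q i * q b)
        else if j ∈ Finset.Ioo a b then sgn (q a * q j) else 1 := by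
    split_ifs with h1 h2
    · subst h1
      rw [← Finset.prod_filter]
      refine Finset.prod_congr ?_ fun _ _ => rfl
      ext i
      simp only [Finset.mem_filter, Finset.mem_Iio, Finset.mem_Ico, Equiv.swap_apply_right]
      rw [and_comm]
      refine and_congr_left fun hi => ?_
      rcases eq_or_ne i a with rfl | hia
      · simp [hab]
      · rw [Equiv.swap_apply_of_ne_of_ne hia hi.ne]
        exact ⟨le_of_lt, fun h => lt_of_le_of_ne h hia.symm⟩
    · have hj := Finset.mem_Ioo.mp h2
      rw [Finset.prod_eq_single a]
      · simp [Equiv.swap_apply_of_ne_of_ne hj.1.ne' hj.2.ne, hj.2]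
      · intro i hi hia
        have hi := Finset.mem_Iio.mp hi
        rw [Equiv.swap_apply_of_ne_of_ne hj.1.ne' hj.2.ne,
          Equiv.swap_apply_of_ne_of_ne hia (hi.trans hj.2).ne, if_neg hi.not_gt]
      · intro h
        exact absurd (Finset.mem_Iio.mpr hj.1) h
    · refine Finset.prod_eq_one fun i hi => if_neg ?_
      have hi := Finset.mem_Iio.mp hi
      simp only [Finset.mem_Ioo, not_and, not_lt] at h2
      simp only [Equiv.swap_apply_def]
      split_ifs <;> omega
  rw [permSign, Finset.prod_congr rfl fun j _ => hinner j,
    ← Finset.mul_prod_erase _ _ (Finset.mem_univ b), if_pos rfl]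
  have h2 : ∏ j ∈ Finset.univ.erase b,
      (if j = b then ∏ i ∈ Finset.Ico a b, sgn (q i * q b)
        else if j ∈ Finset.Ioo a b then sgn (q a * q j) else 1) =
      ∏ j ∈ Finset.Ioo a b, sgn (q a * q j) := by
    rw [Finset.prod_congr rfl fun j hj => if_neg (Finset.ne_of_mem_erase hj),
      ← Finset.prod_filter]
    refine Finset.prod_congr ?_ fun _ _ => rfl
    ext j
    simp only [Finset.mem_filter, Finset.mem_erase, Finset.mem_univ, and_true, Finset.mem_Ioo]
    exact ⟨fun h => h.2, fun h => ⟨h.2.ne, h⟩⟩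
  rw [h2, ← Finset.Ioo_insert_left hab, Finset.prod_insert Finset.left_notMem_Ioo, mul_assoc,
    ← Finset.prod_mul_distrib]
  congr 1
  refine Finset.prod_congr rfl fun s _ => ?_
  rw [add_mul, sgn_add, mul_comm (q b), mul_comm]

/-- The left side is the sign with which `E_ij^(a) E_ji^(b)`, weighted by `(-1)^{p(j)}`, acts on a
basis tensor. The sites to the left of `a` are crossed twice and cancel; the site `a` and those
between `a` and `b` are crossed once. -/
lemma sign_swap_aux (q : Fin N → ZMod 2) {a b : Fin N} (hab : a < b) :
    sgn (q a) * ((∏ s ∈ Finset.Iio b, sgn ((q a + q b) * q s)) *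
      ∏ s ∈ Finset.Iio a, sgn ((q a + q b) * q s)) = permSign q (Equiv.swap a b) := by
  have hI : Finset.Iio b = Finset.Iio a ∪ insert a (Finset.Ioo a b) := by
    rw [Finset.Ioo_insert_left hab]
    ext s
    simp only [Finset.mem_Iio, Finset.mem_union, Finset.mem_Ico]
    omega
  have hd : Disjoint (Finset.Iio a) (insert a (Finset.Ioo a b)) := by
    rw [Finset.Ioo_insert_left hab, Finset.disjoint_left]
    intro s h1 h2
    exact (Finset.mem_Iio.mp h1).not_ge (Finset.mem_Ico.mp h2).1
  have hsq : (∏ s ∈ Finset.Iio a, sgn ((q a + q b) * q s)) *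
      ∏ s ∈ Finset.Iio a, sgn ((q a + q b) * q s) = 1 := by
    rw [← Finset.prod_mul_distrib]
    exact Finset.prod_eq_one fun s _ => sgn_mul_self _
  -- In `ℤ/2` one has `x + (x + y) x = x y`, because `x² = x`.
  have h1 : sgn (q a) * sgn ((q a + q b) * q a) = sgn (q a * q b) := by
    rw [← sgn_add]
    congr 1
    generalize q a = x
    generalize q b = y
    revert x y
    decide
  rw [permSign_swap q hab, hI, Finset.prod_union hd, Finset.prod_insert Finset.left_notMem_Ioo,
    ← h1]
  linear_combination (sgn (q a) * sgn ((q a + q b) * q a) *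
    ∏ s ∈ Finset.Ioo a b, sgn ((q a + q b) * q s)) * hsq

/-- The super transposition in terms of matrix units. -/
lemma permOp_swap {a b : Fin N} (hab : a ≠ b) :
    permOp m n N (Equiv.swap a b) = ∑ i, ∑ j, sgn (par j) •
      (siteGl m n N a (Matrix.single i j 1) * siteGl m n N b (Matrix.single j i 1)) := by
  wlog h : a < b generalizing a b
  · rw [Equiv.swap_comm, this hab.symm (lt_of_le_of_ne (not_lt.mp h) hab.symm), Finset.sum_comm]
    refine Finset.sum_congr rfl fun i _ => Finset.sum_congr rfl fun j _ => ?_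
    -- Both matrix units have parity `p(i) + p(j)`, so exchanging them gives `(-1)^{p(i) + p(j)}`,
    -- which turns the weight `(-1)^{p(i)}` into `(-1)^{p(j)}`.
    rw [siteGl_comm (single_mem_glPart i j) (single_mem_glPart j i) hab, smul_smul, ← sgn_add]
    congr 2
    generalize par i = x
    generalize par j = y
    revert x y
    decide
  refine end_ext fun w => ?_
  simp only [LinearMap.sum_apply, LinearMap.smul_apply, Module.End.mul_apply,
    siteGl_single_basisTensor]
  -- `E_ji` at `b` forces `i = w b`, and then `E_ij` at `a` forces `j = w a`.
  rw [Finset.sum_eq_single (w b), Finset.sum_eq_single (w a), permOp_basisTensor]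
  · simp only [if_true, map_smul, siteGl_single_basisTensor, Function.update_of_ne hab, smul_smul]
    congr 1
    · rw [← sign_swap_aux _ h]
      congr 2
      refine Finset.prod_congr rfl fun s hs => ?_
      rw [Function.update_of_ne ((Finset.mem_Iio.mp hs).trans h).ne, add_comm (par (w b))]
    · congr 1
      funext t
      rw [Equiv.swap_inv]
      rcases eq_or_ne t a with rfl | hta
      · simp
      · rcases eq_or_ne t b with rfl | htb
        · simp [hta]
        · simp [hta, htb, Equiv.swap_apply_of_ne_of_ne hta htb]
  · intro j _ hj
    simp [siteGl_single_basisTensor, Function.update_of_ne hab, hj.symm]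
  · simp
  · intro i _ hi
    simp [hi.symm]
  · simp

end swap

/-! ### Cycles in terms of matrix units -/

section cycle

variable {m n N : ℕ}

/-- The sum of the products `E_{i k_1} E_{k_1 k_2} ... E_{k_r j}`, with the signs
`(-1)^{p(k_1) + ... + p(k_r)}`, where the factors act at the sites in a list. -/
def pathOp (m n N : ℕ) : List (Fin N) → Idx m n → Idx m n → Module.End ℂ (TensorSpace m n N)
  -- A default value: only nonempty lists occur below.
  | [], _, _ => 0
  | [t], i, j => siteGl m n N t (Matrix.single i j 1)
  | t :: u :: ts, i, j => ∑ k, sgn (par k) •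
      (siteGl m n N t (Matrix.single i k 1) * pathOp m n N (u :: ts) k j)

lemma siteGl_single_mul (t : Fin N) (i j k l : Idx m n) :
    siteGl m n N t (Matrix.single i j 1) * siteGl m n N t (Matrix.single k l 1) =
      if j = k then siteGl m n N t (Matrix.single i l 1) else 0 := by
  rw [siteGl_mul (single_mem_glPart i j) (single_mem_glPart k l)]
  split_ifs with h
  · subst h
    simp
  · rw [Matrix.single_mul_single_of_ne _ _ _ _ h, map_zero]

/-- The matrix unit contracts with the first factor of the path, which acts at the same site; this
is what joins a transposition to a shorter cycle. -/
lemma siteGl_single_mul_pathOp (t : Fin N) (ts : List (Fin N)) (i j k l : Idx m n) :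
    siteGl m n N t (Matrix.single i j 1) * pathOp m n N (t :: ts) k l =
      if j = k then pathOp m n N (t :: ts) i l else 0 := by
  cases ts with
  | nil => exact siteGl_single_mul t i j k l
  | cons u ts =>
    simp only [pathOp, Finset.mul_sum, mul_smul_comm, ← mul_assoc, siteGl_single_mul]
    split_ifs with h <;> simp

/-- The cycle `(t, u, ...)` is the transposition of `t` and `u` times the cycle `(u, ...)`. The
factor `E_ji^(u)` of the transposition opens the closed path of the shorter cycle at `i` and makes
it start at `j`, and the remaining `E_ij^(t)` closes it again. -/
lemma permOp_formPerm {t : Fin N} {ts : List (Fin N)} (h : (t :: ts).Nodup) :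
    permOp m n N (t :: ts).formPerm = ∑ i, pathOp m n N (t :: ts) i i := by
  induction ts generalizing t with
  | nil =>
    simp only [pathOp, List.formPerm_singleton, permOp_one]
    rw [← map_sum, Matrix.sum_single_one, siteGl_one]
  | cons u ts ih =>
    have htu : t ≠ u := fun h' => (List.nodup_cons.mp h).1 (by simp [h'])
    rw [List.formPerm_cons_cons, permOp_mul, permOp_swap htu, ih (List.nodup_cons.mp h).2,
      Finset.sum_mul]
    refine Finset.sum_congr rfl fun i _ => ?_
    rw [pathOp, Finset.sum_mul]
    refine Finset.sum_congr rfl fun j _ => ?_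
    rw [smul_mul_assoc, mul_assoc, Finset.mul_sum]
    simp [siteGl_single_mul_pathOp]

/-- Here `w` lists the interior indices of the path: preceded by `i` they are the row indices,
followed by `j` the column indices. -/
lemma pathOp_ofFn {r : ℕ} (t : Fin (r + 1) → Fin N) (i j : Idx m n) :
    pathOp m n N (List.ofFn t) i j = ∑ w : Fin r → Idx m n, sgn (∑ u, par (w u)) •
      (List.ofFn fun u : Fin (r + 1) => siteGl m n N (t u)
        (Matrix.single ((Fin.cons i w : Fin (r + 1) → Idx m n) u)
          ((Fin.snoc w j : Fin (r + 1) → Idx m n) u) 1)).prod := by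
  induction r generalizing i with
  | zero =>
    have : (Fin.snoc (default : Fin 0 → Idx m n) j : Fin 1 → Idx m n) 0 = j :=
      Fin.snoc_last (α := fun _ => Idx m n) j default
    simp [pathOp, sgn_zero, this]
  | succ r ih =>
    rw [← (Fin.consEquiv fun _ => Idx m n).sum_comp, Fintype.sum_prod_type]
    have h1 : pathOp m n N (List.ofFn t) i j = ∑ k, sgn (par k) •
        (siteGl m n N (t 0) (Matrix.single i k 1) *
          pathOp m n N (List.ofFn fun u : Fin (r + 1) => t u.succ) k j) := by
      simp only [List.ofFn_succ, pathOp]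
    rw [h1]
    refine Finset.sum_congr rfl fun k _ => ?_
    rw [ih, Finset.mul_sum, Finset.smul_sum]
    refine Finset.sum_congr rfl fun w _ => ?_
    simp only [Fin.consEquiv, Equiv.coe_fn_mk]
    conv_rhs => rw [List.ofFn_succ, List.prod_cons, Fin.sum_univ_succ,
      ← Fin.cons_snoc_eq_snoc_cons (β := Idx m n)]
    simp only [Fin.cons_zero, Fin.cons_succ, sgn_add, mul_smul_comm, smul_smul]

/-- A cycle acts by the operator which corresponds to `cycleElt`. -/
lemma permOp_formPerm_ofFn {r : ℕ} (hr : 0 < r) {t : Fin r → Fin N}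
    (ht : Function.Injective t) :
    permOp m n N (List.ofFn t).formPerm = ∑ w : Fin r → Idx m n,
      sgn (∑ u with u.val ≠ 0, par (w u)) • (List.ofFn fun u => siteGl m n N (t u)
        (Matrix.single (w u) (w (finRotate r u)) 1)).prod := by
  obtain ⟨r, rfl⟩ := Nat.exists_eq_succ_of_ne_zero hr.ne'
  have h := List.nodup_ofFn.mpr ht
  rw [List.ofFn_succ] at h ⊢
  rw [permOp_formPerm h, ← List.ofFn_succ, ← (Fin.consEquiv fun _ => Idx m n).sum_comp,
    Fintype.sum_prod_type]
  refine Finset.sum_congr rfl fun i _ => ?_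
  rw [pathOp_ofFn]
  refine Finset.sum_congr rfl fun w _ => ?_
  -- The repeated index `i` stands at position `0`, which is left out of the sign. Appending it at
  -- the end of `w` is the cyclic shift of prepending it, which accounts for `finRotate`.
  simp only [Fin.consEquiv, Equiv.coe_fn_mk, Finset.sum_filter, Fin.sum_univ_succ,
    Fin.snoc_eq_cons_rotate]
  simp

end cycle

/-! ### Assembling the blocks of the partition -/

lemma cycleProd_eq_sum (m n : ℕ) {k : ℕ} (ρ : Nat.Partition k) :
    cycleProd m n ρ = ∑ w : ∀ j : Fin (partList ρ).length, Fin ((partList ρ).get j) → Idx m n,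
      (∏ j, sgn (∑ t with t.val ≠ 0, par (w j t))) •
        (List.ofFn fun j => (List.ofFn fun t =>
          symE (w j t) (w j (finRotate _ t))).prod).prod := by
  have : (partList ρ).map (cycleElt m n) =
      List.ofFn fun j => cycleElt m n ((partList ρ).get j) := by
    simp [List.ofFn_getElem_eq_map]
  rw [cycleProd, this]
  simp only [cycleElt]
  rw [sum_prod_ofFn]
  simp only [prod_ofFn_smul]

end SuperSchurWeyl

end

theorem theorem2p4 (m n N k : ℕ) (ρ : Nat.Partition k) (hρ : k ≤ N) :
    SuperSchurWeyl.cycleSum ρ N ∈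
        Subalgebra.center ℂ (MonoidAlgebra ℂ (Equiv.Perm (Fin N))) ∧
      SuperSchurWeyl.permTensor m n N (SuperSchurWeyl.cycleSum ρ N) =
        SuperSchurWeyl.envTensor m n N
          (SuperSchurWeyl.specialSymm m n (SuperSchurWeyl.cycleProd m n ρ)) := by
  open SuperSchurWeyl in
  refine ⟨cycleSum_mem_center ρ N, ?_⟩
  have hpos (j : Fin (partList ρ).length) : 0 < (partList ρ).get j :=
    ρ.parts_pos ((Multiset.mem_sort (· ≥ ·)).mp (List.get_mem _ j))
  -- For fixed matrix indices `w`, the term of `I_ρ` is one monomial with factors indexed by pairs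
  -- (part, position), the same index type as in `cycleSum`.
  have hterm (w : ∀ j : Fin (partList ρ).length, Fin ((partList ρ).get j) → Idx m n) :=
    envTensor_specialSymm_prod (N := N)
      (L := (List.finRange _).sigma fun j => List.finRange ((partList ρ).get j))
      ((List.nodup_finRange _).sigma fun j => List.nodup_finRange _)
      (fun x => List.mem_sigma.mpr ⟨List.mem_finRange _, List.mem_finRange _⟩)
      (fun x => Matrix.single (w x.1 x.2) (w x.1 (finRotate _ x.2)) 1)
      (fun x => par (w x.1 x.2) + par (w x.1 (finRotate _ x.2)))
      fun x => single_mem_glPart _ _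
  simp only [prod_map_sigma] at hterm
  simp only [cycleProd_eq_sum, map_sum, map_smul, symE]
  simp only [hterm, Finset.smul_sum]
  -- With the sum over sites outermost, the two sides are compared for each choice `e` of distinct
  -- sites.
  rw [Finset.sum_comm, cycleSum, map_sum]
  refine Finset.sum_congr rfl fun e _ => ?_
  have hof (τ : Equiv.Perm (Fin N)) :
      permTensor m n N (MonoidAlgebra.of ℂ _ τ) = permOp m n N τ := by
    simp [permTensor]
  rw [map_list_prod, map_list_prod, List.map_ofFn, List.map_ofFn]
  have hcyc : (permTensor m n N ∘ MonoidAlgebra.of ℂ (Equiv.Perm (Fin N)) ∘ fun j =>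
      (List.ofFn fun t => e ⟨j, t⟩).formPerm) = _ :=
    funext fun j => (hof _).trans (permOp_formPerm_ofFn (hpos j)
      (t := fun t => e ⟨j, t⟩) fun a b h => by simpa using e.injective h)
  -- Each cycle is replaced by its sum over matrix indices, and the product of these sums is
  -- expanded as `I_ρ` was.
  rw [hcyc, sum_prod_ofFn]
  simp only [prod_ofFn_smul]
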